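/- Consider one transmission round of vector coded caching. A base station with $L$ antennas and total power budget $P_{\rm tot}>0$ simultaneously serves $G\ge 1$ user groups forming a set $\Psi$, $|\Psi|=G$, with $Q\ge 1$ users in each group. User $k\in[Q]$ of group $\psi\in\Psi$ has $M_{\psi,k}\ge 1$ antennas and is sent $M_{\psi,k}$ independent unit-power symbols, with powers $P_{\psi,k,q}\ge 0$. Let $M_\psi=\sum_{k}M_{\psi,k}$ and assume $L>M_\psi$ for every $\psi\in\Psi$. The channel matrices $H_{\psi,k}\in\mathbb{C}^{L\times M_{\psi,k}}$ have independent entries (independent Rayleigh fading), those of $H_{\psi,k}$ having law $\mathcal{CN}(0,\beta_{\psi,k})$ with pathloss $\beta_{\psi,k}>0$, and the noise at each antenna has power $N_0>0$. With $H_\psi=[H_{\psi,1},\dots,H_{\psi,Q}]$, the zero-forcing precoder of group $\psi$ is $V_\psi=H_\psi^*(H_\psi^TH_\psi^*)^{-1}$ with each column scaled to unit norm. Interference from the other groups is cancelled by means of the cached content, and every user decodes each symbol from the corresponding antenna. The fading-averaged effective rate of user $(\psi,k)$ is $$\bar R_{\psi,k}=\xi_{G,Q}\,\mathbb{E}\Big[\sum_{q=1}^{M_{\psi,k}}\ln(1+\mathrm{SINR}_{\psi,k,q})\Big],\qquad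 \xi_{G,Q}=1-\frac{\Theta}{T}\sum_{\psi\in\Psi}\sum_{k\in[Q]}M_{\psi,k},$$ where $T>0$ is the coherence block period, $\Theta\ge 0$ is the number of pilot symbols per receive antenna and block, and $\xi_{G,Q}>0$. Let $\bar R^\star_{\rm ZF}$ be the sum $\sum_{\psi,k}\bar R_{\psi,k}$ at a power allocation that does not depend on the fading and maximizes $\min_{\psi,k}\bar R_{\psi,k}$ subject to $\sum_{\psi,k,q}P_{\psi,k,q}\le P_{\rm tot}$ (max-min fairness, MMF). Then the averages are finite, such an allocation exists, and $\bar R^\star_{\rm ZF}$ is the same for all such allocations. Moreover $$\widetilde R^\star_{\rm ZF}\le\bar R^\star_{\rm ZF}\le\widehat R^\star_{\rm ZF},$$ where $\widetilde R^\star_{\rm ZF}$ and $\widehat R^\star_{\rm ZF}$ are the unique real solutions of, respectively, $$\sum_{\psi\in\Psi}\sum_{k\in[Q]}\frac{N_0M_{\psi,k}\Big(\exp\Big(\frac{\widetilde R^\star_{\rm ZF}}{\xi_{G,Q}GQM_{\psi,k}}\Big)-1\Big)}{\beta_{\psi,k}(L-M_\psi)}=P_{\rm tot},$$ $$\sum_{\psi\in\Psi}\sum_{k\in[Q]}\frac{N_0M_{\psi,k}\Big(\exp\Big(\frac{\widehat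 R^\star_{\rm ZF}}{\xi_{G,Q}GQM_{\psi,k}}\Big)-1\Big)}{\beta_{\psi,k}(L-M_\psi+1)}=P_{\rm tot}.$$ If $M_{\psi,k}=M$ for all $\psi\in\Psi$ and $k\in[Q]$, then $$\widetilde R^\star_{\rm ZF}=\xi_{G,Q}GQM\ln\Big(1+\frac{P_{\rm tot}(L-QM)}{MN_0\sum_{\psi\in\Psi}\sum_{k\in[Q]}\beta_{\psi,k}^{-1}}\Big),\qquad \widehat R^\star_{\rm ZF}=\xi_{G,Q}GQM\ln\Big(1+\frac{P_{\rm tot}(L-QM+1)}{MN_0\sum_{\psi\in\Psi}\sum_{k\in[Q]}\beta_{\psi,k}^{-1}}\Big).$$ -/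

import Mathlib

open MeasureTheory ProbabilityTheory
open scoped Matrix BigOperators

noncomputable section

/-- Parameters of one transmission round of vector coded caching. `Ψ` is the set of the user
groups served in the round (so `G = |Ψ|`), and `Q` users are served in each group. -/
structure VCCParams (Ψ : Type*) where
  /-- number of transmit antennas -/
  L : ℕ
  /-- number of served users per group -/
  Q : ℕ
  /-- number of receive antennas of each served user (also the number of symbols sent to it) -/
  M : Ψ → Fin Q → ℕ
  /-- large-scale fading / pathloss of each served user -/
  β : Ψ → Fin Q → ℝ
  /-- noise power -/
  N₀ : ℝ
  /-- maximum allowable transmit power -/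
  Ptot : ℝ
  /-- coherence block period, in symbols -/
  T : ℝ
  /-- number of pilot symbols per receive antenna and per coherence block -/
  Θ : ℝ

namespace VCCParams

variable {Ψ : Type*} (p : VCCParams Ψ)

/-- The number `G` of groups served simultaneously. -/
def G [Fintype Ψ] : ℕ := Fintype.card Ψ

/-- The total number `M_ψ` of active receive antennas in group `ψ`. -/
def Mgrp (ψ : Ψ) : ℕ := ∑ k, p.M ψ k

/-- The factor `ξ_{G,Q} = 1 - Θ (∑ M_{ψ,k}) / T` accounting for the CSI costs. -/
def ξ [Fintype Ψ] : ℝ := 1 - p.Θ * (∑ ψ, ∑ k, (p.M ψ k : ℝ)) / p.T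

/-- The symbol streams of group `ψ`: the `q`-th symbol of the `k`-th user. -/
abbrev Stream (ψ : Ψ) : Type := (k : Fin p.Q) × Fin (p.M ψ k)

/-- A realization of all channel matrices `H_{ψ,k} ∈ ℂ^{L × M_{ψ,k}}`. -/
abbrev Channel : Type _ := (ψ : Ψ) → (k : Fin p.Q) → Matrix (Fin p.L) (Fin (p.M ψ k)) ℂ

/-- A power allocation: the power `P_{ψ,k,q}` of each symbol. -/
abbrev Power : Type _ := (ψ : Ψ) → (k : Fin p.Q) → Fin (p.M ψ k) → ℝ

/-- The circularly symmetric complex Gaussian law `CN(0, v)` on `ℂ`: independent real and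
imaginary parts, each centred of variance `v / 2`. -/
def complexGaussian (v : ℝ) : Measure ℂ :=
  ((gaussianReal 0 (v / 2).toNNReal).prod (gaussianReal 0 (v / 2).toNNReal)).map
    Complex.measurableEquivRealProd.symm

/-- Independent Rayleigh fading with pathloss: all channel coefficients are independent and the
entries of `H_{ψ,k}` have law `CN(0, β_{ψ,k})`. -/
structure IsRayleigh {Ω : Type*} [MeasurableSpace Ω] (μ : Measure Ω) (H : Ω → p.Channel) :
    Prop where
  law : ∀ ψ k i q, HasLaw (fun ω => H ω ψ k i q) (complexGaussian (p.β ψ k)) μ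
  indep : iIndepFun
    (fun (c : (ψ : Ψ) × (k : Fin p.Q) × Fin p.L × Fin (p.M ψ k)) ω =>
      H ω c.1 c.2.1 c.2.2.1 c.2.2.2) μ

/-- The group channel matrix `H_ψ = [H_{ψ,1}, …, H_{ψ,Q}] ∈ ℂ^{L × M_ψ}`. -/
def groupChannel (h : p.Channel) (ψ : Ψ) : Matrix (Fin p.L) (p.Stream ψ) ℂ :=
  Matrix.of fun i s => h ψ s.1 i s.2

/-- `(H_ψᵀ H_ψ^*)⁻¹`, where `^*` is entrywise conjugation. -/
def gramInv (h : p.Channel) (ψ : Ψ) : Matrix (p.Stream ψ) (p.Stream ψ) ℂ :=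
  ((p.groupChannel h ψ)ᵀ * (p.groupChannel h ψ).map star)⁻¹

/-- The matrix `D_ψ` normalizing the columns of the precoder: all entries of its column `s` are
`([(H_ψᵀ H_ψ^*)⁻¹]_{s,s})^{-1/2}`. -/
def zfNormalization (h : p.Channel) (ψ : Ψ) : Matrix (Fin p.L) (p.Stream ψ) ℂ :=
  Matrix.of fun _ s => (((Real.sqrt (p.gramInv h ψ s s).re)⁻¹ : ℝ) : ℂ)

/-- The zero-forcing precoder `V_ψ = (H_ψ^* (H_ψᵀ H_ψ^*)⁻¹) ∘ D_ψ` (`∘` the Hadamard product). -/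
def zfPrecoder (h : p.Channel) (ψ : Ψ) : Matrix (Fin p.L) (p.Stream ψ) ℂ :=
  ((p.groupChannel h ψ).map star * p.gramInv h ψ) ⊙ p.zfNormalization h ψ

/-- The coefficients `H_ψᵀ V_ψ` of the effective channel in group `ψ`: the entry `(s, s')` is the
gain of the unit-power symbol `s'` at the receive antenna that decodes the symbol `s` (the
receivers use the identity as decoding matrix). -/
def effChannel (h : p.Channel) (ψ : Ψ) : Matrix (p.Stream ψ) (p.Stream ψ) ℂ :=
  (p.groupChannel h ψ)ᵀ * p.zfPrecoder h ψ

/-- The SINR for decoding stream `s` of group `ψ`, after the signals of the other groups, which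
are known from the cached content, have been removed from the received signal. -/
def sinr (P : p.Power) (h : p.Channel) (ψ : Ψ) (s : p.Stream ψ) : ℝ :=
  P ψ s.1 s.2 * ‖p.effChannel h ψ s s‖ ^ 2 /
    (p.N₀ + ∑ s' ∈ Finset.univ.erase s, P ψ s'.1 s'.2 * ‖p.effChannel h ψ s s'‖ ^ 2)

variable [Fintype Ψ]

/-- The instantaneous effective rate (nats/s/Hz) of the `k`-th user of group `ψ`. -/
def userRate (P : p.Power) (h : p.Channel) (ψ : Ψ) (k : Fin p.Q) : ℝ :=
  p.ξ * ∑ q, Real.log (1 + p.sinr P h ψ ⟨k, q⟩)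

variable {Ω : Type*} [MeasurableSpace Ω] (μ : Measure Ω) (H : Ω → p.Channel)

/-- The effective rate of a user, averaged over the channel fading. -/
def avgUserRate (P : p.Power) (ψ : Ψ) (k : Fin p.Q) : ℝ :=
  ∫ ω, p.userRate P (H ω) ψ k ∂μ

/-- The fading-averaged effective sum-rate over all `G Q` served users. -/
def avgSumRate (P : p.Power) : ℝ := ∑ ψ, ∑ k, p.avgUserRate μ H P ψ k

/-- The smallest fading-averaged effective rate among the `G Q` served users. -/
def minAvgRate (P : p.Power) : ℝ := ⨅ u : Ψ × Fin p.Q, p.avgUserRate μ H P u.1 u.2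

/-- The admissible power allocations: nonnegative powers of total at most `P_tot`. -/
def Feasible (P : p.Power) : Prop :=
  (∀ ψ k q, 0 ≤ P ψ k q) ∧ ∑ ψ, ∑ k, ∑ q, P ψ k q ≤ p.Ptot

/-- `P` solves the max-min fairness (MMF) problem for the fading-averaged rates: it maximizes the
minimum rate of the served users among all admissible (fading-independent) allocations. -/
def IsMMFOptimal (P : p.Power) : Prop :=
  p.Feasible P ∧ ∀ P', p.Feasible P' → p.minAvgRate μ H P' ≤ p.minAvgRate μ H P

/-- `R` is an MMF-optimized fading-averaged effective sum-rate: the sum-rate attained by a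
solution of the MMF problem. -/
def IsMMFSumRate (R : ℝ) : Prop := ∃ P, p.IsMMFOptimal μ H P ∧ p.avgSumRate μ H P = R

/-- The equation that defines the lower bound. -/
def LowerEq (R : ℝ) : Prop :=
  ∑ ψ, ∑ k, p.N₀ * p.M ψ k * (Real.exp (R / (p.ξ * G (Ψ := Ψ) * p.Q * p.M ψ k)) - 1) /
    (p.β ψ k * ((p.L : ℝ) - p.Mgrp ψ)) = p.Ptot

/-- The equation that defines the upper bound. -/
def UpperEq (R : ℝ) : Prop :=
  ∑ ψ, ∑ k, p.N₀ * p.M ψ k * (Real.exp (R / (p.ξ * G (Ψ := Ψ) * p.Q * p.M ψ k)) - 1) /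
    (p.β ψ k * ((p.L : ℝ) - p.Mgrp ψ + 1)) = p.Ptot

end VCCParams

end

/- Zero-forcing turns the SINR of a stream into its power times the squared distance of its
channel vector to the span of the other channel vectors of its group. Given those vectors, this is
the squared norm of the projection of an isotropic Gaussian vector to a space of dimension
`L - M_ψ + 1`, so the gain has mean `β (L - M_ψ + 1)` and its inverse has mean `1 / (β (L - M_ψ))`.
Since `x ↦ ln (1 + a x)` is concave and `y ↦ ln (1 + a / y)` is convex, Jensen's inequality puts
every fading-averaged rate between the rates for the deterministic gains `β (L - M_ψ)` and
`β (L - M_ψ + 1)`. At a max-min optimum all users have the same rate, because a user above the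
minimum could give power to all others; so it suffices to compare the total powers that a given
common rate requires in the three cases. -/

noncomputable section

open scoped ENNReal
open Module (finrank)

section InfDist

variable {𝕜 E : Type*} [RCLike 𝕜] [NormedAddCommGroup E] [InnerProductSpace 𝕜 E]
  (U : Submodule 𝕜 E) [U.HasOrthogonalProjection]

lemma infDist_submodule_eq_norm (x : E) :
    Metric.infDist x U = ‖Uᗮ.orthogonalProjectionOnto x‖ := by
  rw [Metric.infDist_eq_iInf, Submodule.orthogonalProjectionOnto_orthogonal, Submodule.coe_norm,
    Submodule.starProjection_minimal]
  simp only [dist_eq_norm]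
  rfl

lemma infDist_submodule_smul (c : 𝕜) (x : E) :
    Metric.infDist (c • x) U = ‖c‖ * Metric.infDist x U := by
  rw [infDist_submodule_eq_norm, infDist_submodule_eq_norm, map_smul, norm_smul]

end InfDist

section StdGaussian

variable {E : Type*} [NormedAddCommGroup E] [InnerProductSpace ℝ E] [FiniteDimensional ℝ E]
  [MeasurableSpace E] [BorelSpace E]

lemma integral_exp_neg_mul_sq_gaussianReal {b : ℝ} (hb : -(1 / 2) < b) :
    ∫ x, Real.exp (-b * x ^ 2) ∂gaussianReal 0 1 = (1 + 2 * b) ^ (-(1 / 2) : ℝ) := by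
  have hdensity (x : ℝ) : gaussianPDFReal 0 1 x • Real.exp (-b * x ^ 2) =
      (√(2 * Real.pi))⁻¹ * Real.exp (-(1 / 2 + b) * x ^ 2) := by
    rw [gaussianPDFReal, smul_eq_mul, mul_assoc, ← Real.exp_add]
    simp only [NNReal.coe_one]
    ring_nf
  have hb' : 0 < 1 + 2 * b := by linarith
  rw [integral_gaussianReal_eq_integral_smul one_ne_zero, integral_congr_ae (ae_of_all _ hdensity),
    integral_const_mul, integral_gaussian, ← Real.sqrt_inv, ← Real.sqrt_mul (by positivity),
    Real.rpow_neg hb'.le, ← Real.sqrt_eq_rpow, ← Real.sqrt_inv]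
  congr 1
  field_simp

lemma integral_exp_neg_mul_normSq_stdGaussian {b : ℝ} (hb : -(1 / 2) < b) :
    ∫ x, Real.exp (-b * ‖x‖ ^ 2) ∂stdGaussian E = (1 + 2 * b) ^ (-(finrank ℝ E / 2) : ℝ) := by
  have hexp (x : Fin (finrank ℝ E) → ℝ) :
      Real.exp (-b * ‖∑ i, x i • stdOrthonormalBasis ℝ E i‖ ^ 2) =
        ∏ i, Real.exp (-b * x i ^ 2) := by
    rw [← (stdOrthonormalBasis ℝ E).sum_sq_inner_right, ← Real.exp_sum, Finset.mul_sum]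
    simp [inner_sum, inner_smul_right, orthonormal_iff_ite.1 (stdOrthonormalBasis ℝ E).orthonormal]
  rw [stdGaussian, integral_map (Measurable.aemeasurable (by fun_prop)) (by fun_prop),
    integral_congr_ae (ae_of_all _ hexp),
    integral_fintype_prod_eq_prod (f := fun _ x => Real.exp (-b * x ^ 2))]
  simp only [integral_exp_neg_mul_sq_gaussianReal hb, Finset.prod_const, Finset.card_univ,
    Fintype.card_fin]
  rw [← Real.rpow_natCast, ← Real.rpow_mul (by linarith)]
  ring_nf

lemma lintegral_exp_neg_mul_normSq_stdGaussian {b : ℝ} (hb : -(1 / 2) < b) :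
    ∫⁻ x, ENNReal.ofReal (Real.exp (-b * ‖x‖ ^ 2)) ∂stdGaussian E =
      ENNReal.ofReal ((1 + 2 * b) ^ (-(finrank ℝ E / 2) : ℝ)) := by
  have hpos : 0 < (1 + 2 * b) ^ (-(finrank ℝ E / 2) : ℝ) := Real.rpow_pos_of_pos (by linarith) _
  have hint : Integrable (fun x => Real.exp (-b * ‖x‖ ^ 2)) (stdGaussian E) :=
    .of_integral_ne_zero (by rw [integral_exp_neg_mul_normSq_stdGaussian hb]; exact hpos.ne')
  rw [← ofReal_integral_eq_lintegral_ofReal hint (ae_of_all _ fun x => (Real.exp_pos _).le),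
    integral_exp_neg_mul_normSq_stdGaussian hb]

lemma lintegral_normSq_stdGaussian :
    ∫⁻ x, ENNReal.ofReal (‖x‖ ^ 2) ∂stdGaussian E = finrank ℝ E := by
  have hcoord (i : Fin (finrank ℝ E)) :
      ∫⁻ x, ENNReal.ofReal (inner ℝ (stdOrthonormalBasis ℝ E i) x ^ 2) ∂stdGaussian E = 1 := by
    let f : StrongDual ℝ E := innerSL ℝ (stdOrthonormalBasis ℝ E i)
    have hf : MemLp f 2 (stdGaussian E) := IsGaussian.memLp_dual _ f 2 (by simp)
    have hvar : ∫ x, f x ^ 2 ∂stdGaussian E = 1 := by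
      rw [← variance_of_integral_eq_zero hf.aestronglyMeasurable.aemeasurable
        (integral_strongDual_stdGaussian f), variance_dual_stdGaussian]
      simp [f]
    rw [← ENNReal.ofReal_one, ← hvar,
      ofReal_integral_eq_lintegral_ofReal hf.integrable_sq (ae_of_all _ fun _ => sq_nonneg _)]
    rfl
  simp_rw [← (stdOrthonormalBasis ℝ E).sum_sq_inner_right,
    ENNReal.ofReal_sum_of_nonneg fun _ _ => sq_nonneg _]
  rw [lintegral_finsetSum _ (fun i _ => by fun_prop)]
  simp [hcoord]

lemma lintegral_Ioi_one_exp_neg_mul {x : ℝ} (hx : 0 ≤ x) :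
    ∫⁻ u in Set.Ioi (1 : ℝ), ENNReal.ofReal (Real.exp (-((u - 1) / 2) * x)) =
      2 * (ENNReal.ofReal x)⁻¹ := by
  rcases hx.eq_or_lt with rfl | hx
  · simp
  have hexp (u : ℝ) : Real.exp (-((u - 1) / 2) * x) =
      Real.exp (x / 2) * Real.exp (-(x / 2) * u) := by
    rw [← Real.exp_add]
    ring_nf
  have hint := (integrableOn_exp_mul_Ioi (a := -(x / 2)) (by linarith) 1).const_mul
    (Real.exp (x / 2))
  simp_rw [hexp]
  rw [← ofReal_integral_eq_lintegral_ofReal hint (ae_of_all _ fun u => by positivity),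
    integral_const_mul, integral_exp_mul_Ioi (by linarith), ← ENNReal.ofReal_inv_of_pos hx,
    ← ENNReal.ofReal_ofNat 2, ← ENNReal.ofReal_mul zero_le_two, mul_one, neg_div_neg_eq,
    mul_div_assoc', ← Real.exp_add]
  congr 1
  simp
  field_simp

lemma lintegral_Ioi_one_rpow {a : ℝ} (ha : a < -1) :
    ∫⁻ u in Set.Ioi (1 : ℝ), ENNReal.ofReal (u ^ a) = ENNReal.ofReal (-(a + 1))⁻¹ := by
  rw [← ofReal_integral_eq_lintegral_ofReal (integrableOn_Ioi_rpow_of_lt ha one_pos)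
    (ae_restrict_of_forall_mem measurableSet_Ioi fun u hu =>
      Real.rpow_nonneg (zero_le_one.trans (le_of_lt hu)) a), integral_Ioi_rpow_of_lt ha one_pos]
  simp [neg_div, neg_inv]

lemma lintegral_inv_normSq_stdGaussian (hE : 2 < finrank ℝ E) :
    ∫⁻ x, (ENNReal.ofReal (‖x‖ ^ 2))⁻¹ ∂stdGaussian E =
      ENNReal.ofReal (finrank ℝ E - 2 : ℝ)⁻¹ := by
  have hE' : (2 : ℝ) < finrank ℝ E := by exact_mod_cast hE
  have hswap : 2 * ∫⁻ x, (ENNReal.ofReal (‖x‖ ^ 2))⁻¹ ∂stdGaussian E =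
      ENNReal.ofReal (-(-(finrank ℝ E / 2) + 1) : ℝ)⁻¹ :=
    calc 2 * ∫⁻ x, (ENNReal.ofReal (‖x‖ ^ 2))⁻¹ ∂stdGaussian E
        = ∫⁻ x, (∫⁻ u in Set.Ioi (1 : ℝ),
            ENNReal.ofReal (Real.exp (-((u - 1) / 2) * ‖x‖ ^ 2))) ∂stdGaussian E := by
          simp_rw [lintegral_Ioi_one_exp_neg_mul (sq_nonneg ‖_‖)]
          rw [lintegral_const_mul _ (by fun_prop)]
      _ = ∫⁻ u in Set.Ioi (1 : ℝ), (∫⁻ x,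
            ENNReal.ofReal (Real.exp (-((u - 1) / 2) * ‖x‖ ^ 2)) ∂stdGaussian E) :=
          lintegral_lintegral_swap (by fun_prop)
      _ = ∫⁻ u in Set.Ioi (1 : ℝ), ENNReal.ofReal (u ^ (-(finrank ℝ E / 2) : ℝ)) := by
          refine setLIntegral_congr_fun measurableSet_Ioi fun u hu => ?_
          have hu' : 1 < u := hu
          rw [lintegral_exp_neg_mul_normSq_stdGaussian (by linarith)]
          ring_nf
      _ = _ := lintegral_Ioi_one_rpow (by linarith)
  refine (ENNReal.mul_right_inj two_ne_zero ENNReal.ofNat_ne_top).1 (hswap.trans ?_)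
  rw [← ENNReal.ofReal_ofNat 2, ← ENNReal.ofReal_mul zero_le_two,
    show (-(-(finrank ℝ E / 2) + 1) : ℝ) = (finrank ℝ E - 2) / 2 by ring, inv_div, div_eq_mul_inv]

lemma stdGaussian_map_orthogonalProjectionOnto (U : Submodule ℝ E) :
    (stdGaussian E).map U.orthogonalProjectionOnto = stdGaussian U := by
  have := Measure.isProbabilityMeasure_map (μ := stdGaussian E) (f := U.orthogonalProjectionOnto)
    (by fun_prop)
  refine Measure.ext_of_charFun (funext fun t => ?_)
  rw [charFun_apply, integral_map (by fun_prop) (by fun_prop), charFun_stdGaussian]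
  simp_rw [Submodule.inner_orthogonalProjectionOnto_eq_of_mem_right]
  rw [← charFun_apply, charFun_stdGaussian, Submodule.coe_norm]

lemma lintegral_infDist_sq_stdGaussian (U : Submodule ℝ E) :
    ∫⁻ x, ENNReal.ofReal (Metric.infDist x U ^ 2) ∂stdGaussian E = finrank ℝ Uᗮ := by
  rw [← lintegral_normSq_stdGaussian, ← stdGaussian_map_orthogonalProjectionOnto,
    lintegral_map (by fun_prop) (by fun_prop)]
  simp only [infDist_submodule_eq_norm]

lemma lintegral_inv_infDist_sq_stdGaussian (U : Submodule ℝ E) (hU : 2 < finrank ℝ Uᗮ) :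
    ∫⁻ x, (ENNReal.ofReal (Metric.infDist x U ^ 2))⁻¹ ∂stdGaussian E =
      ENNReal.ofReal (finrank ℝ Uᗮ - 2 : ℝ)⁻¹ := by
  rw [← lintegral_inv_normSq_stdGaussian hU, ← stdGaussian_map_orthogonalProjectionOnto,
    lintegral_map (by fun_prop) (by fun_prop)]
  simp only [infDist_submodule_eq_norm]

end StdGaussian

section IsotropicGaussian

/-- The centred isotropic Gaussian law with variance `v` in each real direction. Thus `CN(0, v)`
is `isotropicGaussian ℂ (v / 2)`. -/
def isotropicGaussian (E : Type*) [NormedAddCommGroup E] [InnerProductSpace ℝ E]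
    [FiniteDimensional ℝ E] [MeasurableSpace E] (v : ℝ) : Measure E :=
  (stdGaussian E).map (√v • ·)

variable {E : Type*} [NormedAddCommGroup E] [InnerProductSpace ℝ E] [FiniteDimensional ℝ E]
  [MeasurableSpace E] [BorelSpace E]

instance isProbabilityMeasure_isotropicGaussian (v : ℝ) :
    IsProbabilityMeasure (isotropicGaussian E v) :=
  Measure.isProbabilityMeasure_map (by fun_prop)

lemma charFun_isotropicGaussian {v : ℝ} (hv : 0 ≤ v) (t : E) :
    charFun (isotropicGaussian E v) t = Complex.exp (-(v * ‖t‖ ^ 2 / 2 : ℝ)) := by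
  rw [isotropicGaussian, charFun_map_smul, charFun_stdGaussian, norm_smul, Real.norm_eq_abs,
    abs_of_nonneg (Real.sqrt_nonneg v), ← Complex.ofReal_pow, mul_pow, Real.sq_sqrt hv]
  push_cast
  ring_nf

lemma map_pi_isotropicGaussian {ι : Type*} [Fintype ι] {v : ℝ} (hv : 0 ≤ v) :
    (Measure.pi fun _ : ι => isotropicGaussian E v).map (WithLp.toLp 2) =
      isotropicGaussian (PiLp 2 fun _ : ι => E) v := by
  have := Measure.isProbabilityMeasure_map (μ := Measure.pi fun _ : ι => isotropicGaussian E v)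
    (f := WithLp.toLp 2) (by fun_prop)
  refine Measure.ext_of_charFun (funext fun t => ?_)
  rw [charFun_pi, charFun_isotropicGaussian hv, PiLp.norm_sq_eq_of_L2]
  simp_rw [charFun_isotropicGaussian hv, ← Complex.exp_sum]
  push_cast
  rw [Finset.mul_sum, Finset.sum_div, Finset.sum_neg_distrib]

lemma ofReal_infDist_sq_sqrt_smul {E : Type*} [NormedAddCommGroup E] [InnerProductSpace ℝ E]
    (U : Submodule ℝ E) [U.HasOrthogonalProjection] {v : ℝ} (hv : 0 ≤ v) (x : E) :
    ENNReal.ofReal (Metric.infDist (√v • x) U ^ 2) =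
      ENNReal.ofReal v * ENNReal.ofReal (Metric.infDist x U ^ 2) := by
  rw [infDist_submodule_smul, mul_pow, Real.norm_eq_abs, sq_abs, Real.sq_sqrt hv,
    ENNReal.ofReal_mul hv]

lemma lintegral_infDist_sq_isotropicGaussian (U : Submodule ℝ E) {v : ℝ} (hv : 0 ≤ v) :
    ∫⁻ x, ENNReal.ofReal (Metric.infDist x U ^ 2) ∂isotropicGaussian E v =
      ENNReal.ofReal (v * finrank ℝ Uᗮ) := by
  rw [isotropicGaussian, lintegral_map (by fun_prop) (by fun_prop)]
  simp_rw [ofReal_infDist_sq_sqrt_smul U hv]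
  rw [lintegral_const_mul _ (by fun_prop), lintegral_infDist_sq_stdGaussian,
    ENNReal.ofReal_mul hv, ENNReal.ofReal_natCast]

lemma lintegral_inv_infDist_sq_isotropicGaussian (U : Submodule ℝ E) (hU : 2 < finrank ℝ Uᗮ)
    {v : ℝ} (hv : 0 < v) :
    ∫⁻ x, (ENNReal.ofReal (Metric.infDist x U ^ 2))⁻¹ ∂isotropicGaussian E v =
      ENNReal.ofReal (v * (finrank ℝ Uᗮ - 2))⁻¹ := by
  rw [isotropicGaussian, lintegral_map (by fun_prop) (by fun_prop)]
  simp_rw [ofReal_infDist_sq_sqrt_smul U hv.le,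
    ENNReal.mul_inv (Or.inl (ENNReal.ofReal_pos.2 hv).ne') (Or.inl ENNReal.ofReal_ne_top)]
  rw [lintegral_const_mul _ (by fun_prop), lintegral_inv_infDist_sq_stdGaussian U hU,
    ← ENNReal.ofReal_inv_of_pos hv, ← ENNReal.ofReal_mul (inv_nonneg.2 hv.le), mul_inv]

end IsotropicGaussian

section ComplexGaussian

open VCCParams (complexGaussian)

lemma charFun_complexGaussian {v : ℝ} (hv : 0 ≤ v) (t : ℂ) :
    charFun (complexGaussian v) t = Complex.exp (-(v / 2 * ‖t‖ ^ 2 / 2 : ℝ)) := by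
  have hexp (x : ℝ × ℝ) : Complex.exp (inner ℝ (Complex.measurableEquivRealProd.symm x) t *
      Complex.I) = Complex.exp (t.re * x.1 * Complex.I) * Complex.exp (t.im * x.2 * Complex.I) := by
    rw [← Complex.exp_add]
    congr 1
    simp [Complex.inner, Complex.measurableEquivRealProd_symm_apply]
    ring
  have hvar : (((v / 2).toNNReal : ℝ) : ℂ) = v / 2 := by
    rw [Real.coe_toNNReal _ (by positivity)]
    simp
  rw [charFun_apply, complexGaussian, integral_map (by fun_prop) (by fun_prop),
    integral_congr_ae (ae_of_all _ hexp),
    integral_prod_mul (fun x : ℝ => Complex.exp (t.re * x * Complex.I))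
      (fun x : ℝ => Complex.exp (t.im * x * Complex.I)),
    ← charFun_apply_real, ← charFun_apply_real, charFun_gaussianReal, charFun_gaussianReal,
    ← Complex.exp_add, hvar, Complex.sq_norm, Complex.normSq_apply]
  push_cast
  ring_nf

lemma complexGaussian_eq_isotropicGaussian {v : ℝ} (hv : 0 ≤ v) :
    complexGaussian v = isotropicGaussian ℂ (v / 2) := by
  have : IsProbabilityMeasure (complexGaussian v) :=
    Measure.isProbabilityMeasure_map Complex.measurableEquivRealProd.symm.measurable.aemeasurable
  refine Measure.ext_of_charFun (funext fun t => ?_)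
  rw [charFun_complexGaussian hv, charFun_isotropicGaussian (by positivity)]

end ComplexGaussian

section SpanOthers

variable {𝕜 E σ : Type*}

/-- The span of the members of the family `v` other than `v s`. -/
abbrev spanOthers (𝕜 : Type*) [Semiring 𝕜] [AddCommMonoid E] [Module 𝕜 E] (v : σ → E) (s : σ) :
    Submodule 𝕜 E :=
  Submodule.span 𝕜 (Set.range fun j : {j // j ≠ s} => v j)

lemma linearIndependent_iff_notMem_spanOthers [DivisionRing 𝕜] [AddCommGroup E] [Module 𝕜 E]
    {v : σ → E} : LinearIndependent 𝕜 v ↔ ∀ s, v s ∉ spanOthers 𝕜 v s := by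
  rw [linearIndependent_iff_notMem_span]
  refine forall_congr' fun s => ?_
  rw [show v '' (Set.univ \ {s}) = Set.range fun j : {j // j ≠ s} => v j by ext; simp]

section Finrank

variable [Field 𝕜] [AddCommGroup E] [Module 𝕜 E] [Fintype σ]

lemma finrank_spanOthers_add_one_le (v : σ → E) (s : σ) :
    finrank 𝕜 (spanOthers 𝕜 v s) + 1 ≤ Fintype.card σ := by
  classical
  have hle : finrank 𝕜 (spanOthers 𝕜 v s) ≤ Fintype.card {j // j ≠ s} :=
    finrank_range_le_card fun j : {j // j ≠ s} => v j
  rw [Fintype.card_subtype_compl, Fintype.card_subtype_eq] at hle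
  have := Fintype.card_pos_iff.2 ⟨s⟩
  omega

lemma finrank_spanOthers_add_one {v : σ → E} (hv : LinearIndependent 𝕜 v) (s : σ) :
    finrank 𝕜 (spanOthers 𝕜 v s) + 1 = Fintype.card σ := by
  classical
  have hcard : finrank 𝕜 (spanOthers 𝕜 v s) = Fintype.card {j // j ≠ s} :=
    finrank_span_eq_card (hv.comp _ Subtype.val_injective)
  rw [Fintype.card_subtype_compl, Fintype.card_subtype_eq] at hcard
  have := Fintype.card_pos_iff.2 ⟨s⟩
  omega

end Finrank

lemma infEDist_span_range [NormedField 𝕜] [SeminormedAddCommGroup E] [Module 𝕜 E] [Fintype σ]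
    (v : σ → E) (x : E) :
    Metric.infEDist x (Submodule.span 𝕜 (Set.range v)) = ⨅ c : σ → 𝕜, edist x (∑ j, c j • v j) := by
  simp only [Metric.infEDist, SetLike.mem_coe, Submodule.mem_span_range_iff_exists_fun, iInf_exists]
  rw [iInf_comm]
  simp

lemma measurable_infDist_span_range [NormedField 𝕜] [SeminormedAddCommGroup E] [NormedSpace 𝕜 E]
    [SecondCountableTopology E] [MeasurableSpace E] [BorelSpace E] [Finite σ] :
    Measurable fun x : (σ → E) × E => Metric.infDist x.2 (Submodule.span 𝕜 (Set.range x.1)) := by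
  have := Fintype.ofFinite σ
  refine Measurable.ennreal_toReal ?_
  simp_rw [infEDist_span_range]
  exact (upperSemicontinuous_iInf fun c =>
    Continuous.upperSemicontinuous (by fun_prop)).measurable

section Gram

variable [RCLike 𝕜] [NormedAddCommGroup E] [InnerProductSpace 𝕜 E] [Fintype σ]

lemma gram_mulVec_apply (v : σ → E) (a : σ → 𝕜) (i : σ) :
    (Matrix.gram 𝕜 v *ᵥ a) i = inner 𝕜 (v i) (∑ j, a j • v j) := by
  simp [inner_sum, Matrix.mulVec, dotProduct, inner_smul_right, mul_comm]

lemma exists_sum_smul_eq_of_sub_mem_spanOthers {v : σ → E} {s : σ} {x : E}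
    (hx : v s - x ∈ spanOthers 𝕜 v s) : ∃ a : σ → 𝕜, a s = 1 ∧ ∑ j, a j • v j = x := by
  classical
  obtain ⟨c, hc⟩ := (Submodule.mem_span_range_iff_exists_fun 𝕜).1 hx
  refine ⟨fun j => if hj : j = s then 1 else -c ⟨j, hj⟩, by simp, ?_⟩
  have hothers (j : {j // j ≠ s}) : (if hj : (j : σ) = s then (1 : 𝕜) else -c ⟨j, hj⟩) • v j =
      -(c j • v j) := by
    simp [j.2]
  rw [Fintype.sum_eq_add_sum_subtype_ne _ s, Finset.sum_congr rfl fun j _ => hothers j,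
    Finset.sum_neg_distrib, hc]
  simp

variable [DecidableEq σ]

lemma exists_gram_mulVec_eq_single (v : σ → E) (s : σ) :
    ∃ a : σ → 𝕜, a s = 1 ∧ Matrix.gram 𝕜 v *ᵥ a =
      Pi.single s (Metric.infDist (v s) (spanOthers 𝕜 v s) ^ 2 : 𝕜) := by
  have : FiniteDimensional 𝕜 (spanOthers 𝕜 v s) := .span_of_finite 𝕜 (Set.finite_range _)
  set W := spanOthers 𝕜 v s
  have hsub : v s - Wᗮ.orthogonalProjectionOnto (v s) ∈ W := by
    rw [Submodule.orthogonalProjectionOnto_orthogonal]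
    simp
  obtain ⟨a, has, ha⟩ := exists_sum_smul_eq_of_sub_mem_spanOthers hsub
  refine ⟨a, has, funext fun i => ?_⟩
  rw [gram_mulVec_apply, ha]
  by_cases hi : i = s
  · subst hi
    rw [← Submodule.inner_orthogonalProjectionOnto_eq_of_mem_right, inner_self_eq_norm_sq_to_K,
      infDist_submodule_eq_norm, Pi.single_eq_same]
  · rw [Pi.single_eq_of_ne hi]
    have hiW : v i ∈ W := Submodule.subset_span ⟨(⟨i, hi⟩ : {j // j ≠ s}), rfl⟩
    exact Submodule.inner_right_of_mem_orthogonal hiW (Wᗮ.orthogonalProjectionOnto (v s)).2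

lemma gram_inv_apply_self {v : σ → E} (hv : LinearIndependent 𝕜 v) (s : σ) :
    (Matrix.gram 𝕜 v)⁻¹ s s = ((Metric.infDist (v s) (spanOthers 𝕜 v s) ^ 2)⁻¹ : 𝕜) := by
  have hdet : IsUnit (Matrix.gram 𝕜 v).det :=
    isUnit_iff_ne_zero.2 (Matrix.det_gram_ne_zero_iff_linearIndependent.2 hv)
  obtain ⟨a, has, ha⟩ := exists_gram_mulVec_eq_single (𝕜 := 𝕜) v s
  have hinv : a = (Matrix.gram 𝕜 v)⁻¹ *ᵥ
      Pi.single s (Metric.infDist (v s) (spanOthers 𝕜 v s) ^ 2 : 𝕜) := by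
    rw [← ha, Matrix.mulVec_mulVec, Matrix.nonsing_inv_mul _ hdet, Matrix.one_mulVec]
  refine eq_inv_of_mul_eq_one_left ?_
  simpa [has] using (congrFun hinv s).symm

end Gram

end SpanOthers

section GaussianFamily

variable {Ω : Type*} [MeasurableSpace Ω] {μ : Measure Ω}

lemma lintegral_comp_prod_of_indepFun [IsProbabilityMeasure μ] {α γ : Type*}
    [MeasurableSpace α] [MeasurableSpace γ] {X : Ω → α} {Y : Ω → γ} {ν : Measure γ}
    (hX : AEMeasurable X μ) (hY : HasLaw Y ν μ) (hXY : IndepFun X Y μ) {f : α × γ → ℝ≥0∞}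
    (hf : Measurable f) : ∫⁻ ω, f (X ω, Y ω) ∂μ = ∫⁻ ω, ∫⁻ y, f (X ω, y) ∂ν ∂μ := by
  have : IsProbabilityMeasure ν :=
    hY.map_eq ▸ Measure.isProbabilityMeasure_map hY.aemeasurable
  rw [← lintegral_map' (f := f) hf.aemeasurable (hX.prodMk hY.aemeasurable),
    (indepFun_iff_map_prod_eq_prod_map_map hX hY.aemeasurable).1 hXY, hY.map_eq,
    lintegral_prod _ hf.aemeasurable, lintegral_map' _ hX]
  exact hf.lintegral_prod_right'.aemeasurable

variable {E σ : Type*} [NormedAddCommGroup E] [InnerProductSpace ℝ E] [FiniteDimensional ℝ E]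

lemma finrank_orthogonal_restrictScalars [Module ℂ E] [IsScalarTower ℝ ℂ E] (W : Submodule ℂ E) :
    finrank ℝ (W.restrictScalars ℝ)ᗮ = 2 * (finrank ℂ E - finrank ℂ W : ℝ) := by
  have hE : 2 * finrank ℂ E = finrank ℝ E := by
    rw [← Complex.finrank_real_complex, Module.finrank_mul_finrank]
  have hW : 2 * finrank ℂ W = finrank ℝ (W.restrictScalars ℝ) := by
    rw [← Complex.finrank_real_complex, Module.finrank_mul_finrank ℝ ℂ W]
    rfl
  have hsum := (W.restrictScalars ℝ).finrank_add_finrank_orthogonal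
  rw [← hW, ← hE] at hsum
  have : (2 * finrank ℂ W + finrank ℝ (W.restrictScalars ℝ)ᗮ : ℝ) = 2 * finrank ℂ E := by
    exact_mod_cast hsum
  linarith

variable [MeasurableSpace E]

/-- A random family of vectors of which each `V s` is independent of the others and has as its
coordinates independent `CN(0, β s)` variables: the columns of a matrix under Rayleigh fading. -/
structure IsGaussianFamily (μ : Measure Ω) (V : Ω → σ → E) (β : σ → ℝ) : Prop where
  law : ∀ s, HasLaw (fun ω => V ω s) (isotropicGaussian E (β s / 2)) μ
  indep : ∀ s, IndepFun (fun ω (j : {j // j ≠ s}) => V ω j) (fun ω => V ω s) μ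

namespace IsGaussianFamily

variable {V : Ω → σ → E} {β : σ → ℝ}

lemma aemeasurable_others [Countable σ] (hV : IsGaussianFamily μ V β) (s : σ) :
    AEMeasurable (fun ω (j : {j // j ≠ s}) => V ω j) μ :=
  aemeasurable_pi_lambda _ fun j => (hV.law j).aemeasurable

variable [NormedSpace ℂ E] [BorelSpace E]

lemma aemeasurable_infDist [Finite σ] (hV : IsGaussianFamily μ V β) (s : σ) :
    AEMeasurable (fun ω => Metric.infDist (V ω s) (spanOthers ℂ (V ω) s)) μ :=
  Measurable.comp_aemeasurable (f := fun ω => ((fun j : {j // j ≠ s} => V ω j), V ω s))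
    (measurable_infDist_span_range (𝕜 := ℂ))
    ((hV.aemeasurable_others s).prodMk (hV.law s).aemeasurable)

variable [IsScalarTower ℝ ℂ E] [Fintype σ] [IsProbabilityMeasure μ]

lemma lintegral_inv_infDist_sq_le (hV : IsGaussianFamily μ V β) {s : σ} (hβ : 0 < β s)
    (hσ : Fintype.card σ < finrank ℂ E) :
    ∫⁻ ω, (ENNReal.ofReal (Metric.infDist (V ω s) (spanOthers ℂ (V ω) s) ^ 2))⁻¹ ∂μ ≤
      ENNReal.ofReal (β s * (finrank ℂ E - Fintype.card σ))⁻¹ := by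
  have hσ' : (Fintype.card σ : ℝ) < finrank ℂ E := by exact_mod_cast hσ
  rw [lintegral_comp_prod_of_indepFun (hV.aemeasurable_others s) (hV.law s) (hV.indep s)
    (f := fun x => (ENNReal.ofReal
      (Metric.infDist x.2 (Submodule.span ℂ (Set.range x.1)) ^ 2))⁻¹)
    (measurable_infDist_span_range.pow_const 2).ennreal_ofReal.inv]
  refine (lintegral_mono fun ω => ?_).trans_eq
    ((lintegral_const _).trans (by rw [measure_univ, mul_one]))
  set W := spanOthers ℂ (V ω) s
  have hW : (finrank ℂ W + 1 : ℝ) ≤ Fintype.card σ := by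
    exact_mod_cast finrank_spanOthers_add_one_le (V ω) s
  have hdim := finrank_orthogonal_restrictScalars W
  have hdim' : 2 < finrank ℝ (W.restrictScalars ℝ)ᗮ := by
    have : (2 : ℝ) < finrank ℝ (W.restrictScalars ℝ)ᗮ := by linarith
    exact_mod_cast this
  refine (lintegral_inv_infDist_sq_isotropicGaussian (W.restrictScalars ℝ) hdim'
    (half_pos hβ)).trans_le (ENNReal.ofReal_le_ofReal ?_)
  rw [hdim]
  exact inv_anti₀ (mul_pos hβ (by linarith)) (by nlinarith)

lemma ae_infDist_pos (hV : IsGaussianFamily μ V β) {s : σ} (hβ : 0 < β s)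
    (hσ : Fintype.card σ < finrank ℂ E) :
    ∀ᵐ ω ∂μ, 0 < Metric.infDist (V ω s) (spanOthers ℂ (V ω) s) := by
  have hfinite := ae_lt_top' ((hV.aemeasurable_infDist s).pow_const 2).ennreal_ofReal.inv
    ((hV.lintegral_inv_infDist_sq_le hβ hσ).trans_lt ENNReal.ofReal_lt_top).ne
  filter_upwards [hfinite] with ω hω
  refine Metric.infDist_nonneg.lt_of_ne' fun h => ?_
  simp [h] at hω

lemma ae_linearIndependent (hV : IsGaussianFamily μ V β) (hβ : ∀ s, 0 < β s)
    (hσ : Fintype.card σ < finrank ℂ E) : ∀ᵐ ω ∂μ, LinearIndependent ℂ (V ω) := by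
  filter_upwards [ae_all_iff.2 fun s => hV.ae_infDist_pos (hβ s) hσ] with ω hω
  exact linearIndependent_iff_notMem_spanOthers.2 fun s hs =>
    (hω s).ne' (Metric.infDist_zero_of_mem hs)

lemma lintegral_infDist_sq (hV : IsGaussianFamily μ V β) (hβ : ∀ s, 0 < β s)
    (hσ : Fintype.card σ < finrank ℂ E) (s : σ) :
    ∫⁻ ω, ENNReal.ofReal (Metric.infDist (V ω s) (spanOthers ℂ (V ω) s) ^ 2) ∂μ =
      ENNReal.ofReal (β s * (finrank ℂ E - Fintype.card σ + 1)) := by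
  rw [lintegral_comp_prod_of_indepFun (hV.aemeasurable_others s) (hV.law s) (hV.indep s)
    (f := fun x => ENNReal.ofReal (Metric.infDist x.2 (Submodule.span ℂ (Set.range x.1)) ^ 2))
    (measurable_infDist_span_range.pow_const 2).ennreal_ofReal]
  refine (lintegral_congr_ae ?_).trans ((lintegral_const _).trans (by rw [measure_univ, mul_one]))
  filter_upwards [hV.ae_linearIndependent hβ hσ] with ω hω
  set W := spanOthers ℂ (V ω) s
  have hW : (finrank ℂ W + 1 : ℝ) = Fintype.card σ := by
    exact_mod_cast finrank_spanOthers_add_one hω s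
  refine (lintegral_infDist_sq_isotropicGaussian (W.restrictScalars ℝ) (half_pos (hβ s)).le).trans
    (congrArg ENNReal.ofReal ?_)
  rw [finrank_orthogonal_restrictScalars]
  linear_combination (-β s) * hW

end IsGaussianFamily

end GaussianFamily

section ExpectedLog

lemma abs_log_sub_log_le {x y : ℝ} (hx : 1 ≤ x) (hy : 1 ≤ y) :
    |Real.log x - Real.log y| ≤ |x - y| := by
  wlog hyx : y ≤ x generalizing x y
  · rw [abs_sub_comm, abs_sub_comm x]
    exact this hy hx (le_of_not_ge hyx)
  have hy' : 0 < y := zero_lt_one.trans_le hy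
  rw [abs_of_nonneg (sub_nonneg.2 (Real.log_le_log hy' hyx)), abs_of_nonneg (sub_nonneg.2 hyx),
    ← Real.log_div (hy'.trans_le hyx).ne' hy'.ne']
  refine (Real.log_le_sub_one_of_pos (div_pos (hy'.trans_le hyx) hy')).trans ?_
  rw [div_sub_one hy'.ne']
  exact div_le_self (sub_nonneg.2 hyx) hy

lemma abs_log_one_add_mul_sub_le {a b x : ℝ} (ha : 0 ≤ a) (hb : 0 ≤ b) (hx : 0 ≤ x) :
    |Real.log (1 + a * x) - Real.log (1 + b * x)| ≤ |a - b| * x := by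
  refine (abs_log_sub_log_le (le_add_of_nonneg_right (mul_nonneg ha hx))
    (le_add_of_nonneg_right (mul_nonneg hb hx))).trans_eq ?_
  rw [add_sub_add_left_eq_sub, ← sub_mul, abs_mul, abs_of_nonneg hx]

lemma concaveOn_log_one_add_mul {a : ℝ} (ha : 0 ≤ a) :
    ConcaveOn ℝ (Set.Ici 0) fun x => Real.log (1 + a * x) := by
  refine ⟨convex_Ici 0, fun x hx y hy s t hs ht hst => ?_⟩
  have hx' : 0 < 1 + a * x := by have := mul_nonneg ha hx; linarith
  have hy' : 0 < 1 + a * y := by have := mul_nonneg ha hy; linarith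
  refine (strictConcaveOn_log_Ioi.concaveOn.2 hx' hy' hs ht hst).trans_eq (congrArg Real.log ?_)
  simp only [smul_eq_mul]
  linear_combination hst

lemma log_one_add_div_sub_le {a c y : ℝ} (ha : 0 ≤ a) (hc : 0 < c) (hy : 0 < y) :
    Real.log (1 + a / c) - a / (c * (c + a)) * (y - c) ≤ Real.log (1 + a / y) := by
  have hquot : Real.log (1 + a / c) - Real.log (1 + a / y) ≤ (1 + a / c) / (1 + a / y) - 1 := by
    rw [← Real.log_div (by positivity) (by positivity)]
    exact Real.log_le_sub_one_of_pos (by positivity)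
  have htangent : (1 + a / c) / (1 + a / y) - 1 ≤ a / (c * (c + a)) * (y - c) := by
    refine sub_nonneg.1 (le_of_le_of_eq
      (by positivity : 0 ≤ a * (y - c) ^ 2 / (c * (c + a) * (y + a))) ?_)
    field_simp
    ring
  linarith

lemma sum_log_one_add_mul_le {κ : Type*} [Fintype κ] [Nonempty κ] {a : ℝ} (ha : 0 ≤ a)
    {x : κ → ℝ} (hx : ∀ q, 0 ≤ x q) :
    ∑ q, Real.log (1 + a * x q) ≤
      Fintype.card κ * Real.log (1 + a * ((∑ q, x q) / Fintype.card κ)) := by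
  have hκ : (0 : ℝ) < Fintype.card κ := by exact_mod_cast Fintype.card_pos
  have hJensen := (concaveOn_log_one_add_mul ha).le_map_sum (t := Finset.univ)
    (w := fun _ => (Fintype.card κ : ℝ)⁻¹) (fun _ _ => by positivity)
    (by simp [hκ.ne']) fun q _ => hx q
  simp only [smul_eq_mul, ← Finset.mul_sum] at hJensen
  rwa [inv_mul_le_iff₀ hκ, inv_mul_eq_div] at hJensen

variable {Ω : Type*} [MeasurableSpace Ω] {μ : Measure Ω} {X : Ω → ℝ}

lemma integrable_of_lintegral_ofReal_le {c : ℝ} (hX : AEMeasurable X μ) (hpos : ∀ᵐ ω ∂μ, 0 ≤ X ω)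
    (h : ∫⁻ ω, ENNReal.ofReal (X ω) ∂μ ≤ ENNReal.ofReal c) : Integrable X μ :=
  ⟨hX.aestronglyMeasurable,
    (hasFiniteIntegral_iff_ofReal hpos).2 (h.trans_lt ENNReal.ofReal_lt_top)⟩

lemma integral_le_of_lintegral_ofReal_le {c : ℝ} (hc : 0 ≤ c) (hX : AEMeasurable X μ)
    (hpos : ∀ᵐ ω ∂μ, 0 ≤ X ω) (h : ∫⁻ ω, ENNReal.ofReal (X ω) ∂μ ≤ ENNReal.ofReal c) :
    ∫ ω, X ω ∂μ ≤ c := by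
  rw [integral_eq_lintegral_of_nonneg_ae hpos hX.aestronglyMeasurable]
  exact ENNReal.toReal_le_of_le_ofReal hc h

lemma integrable_log_one_add_mul (hX : Integrable X μ) (hpos : ∀ᵐ ω ∂μ, 0 ≤ X ω) {a : ℝ}
    (ha : 0 ≤ a) : Integrable (fun ω => Real.log (1 + a * X ω)) μ := by
  refine (hX.const_mul |a|).mono' (Real.measurable_log.comp_aemeasurable
    ((hX.aemeasurable.const_mul a).const_add 1)).aestronglyMeasurable ?_
  filter_upwards [hpos] with ω hω
  simpa using abs_log_one_add_mul_sub_le ha le_rfl hω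

lemma continuousOn_integral_log_one_add_mul (hX : Integrable X μ) (hpos : ∀ᵐ ω ∂μ, 0 ≤ X ω) :
    ContinuousOn (fun a => ∫ ω, Real.log (1 + a * X ω) ∂μ) (Set.Ici 0) := by
  refine (LipschitzOnWith.of_dist_le_mul (K := (∫ ω, X ω ∂μ).toNNReal)
    fun a ha b hb => ?_).continuousOn
  rw [Real.coe_toNNReal _ (integral_nonneg_of_ae hpos), dist_eq_norm,
    ← integral_sub (integrable_log_one_add_mul hX hpos ha) (integrable_log_one_add_mul hX hpos hb),
    mul_comm, ← integral_const_mul]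
  refine norm_integral_le_of_norm_le (hX.const_mul _) ?_
  filter_upwards [hpos] with ω hω
  exact abs_log_one_add_mul_sub_le ha hb hω

lemma strictMonoOn_integral_log_one_add_mul [NeZero μ] (hX : Integrable X μ)
    (hpos : ∀ᵐ ω ∂μ, 0 < X ω) :
    StrictMonoOn (fun a => ∫ ω, Real.log (1 + a * X ω) ∂μ) (Set.Ici 0) := by
  intro a (ha : 0 ≤ a) b (hb : 0 ≤ b) hab
  have hpos' : ∀ᵐ ω ∂μ, 0 ≤ X ω := hpos.mono fun _ => le_of_lt
  have hia := integrable_log_one_add_mul hX hpos' ha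
  have hib := integrable_log_one_add_mul hX hpos' hb
  have hlt : ∀ᵐ ω ∂μ, 0 < Real.log (1 + b * X ω) - Real.log (1 + a * X ω) := by
    filter_upwards [hpos] with ω hω
    exact sub_pos.2 (Real.log_lt_log (by positivity) (by gcongr))
  rw [← sub_pos, ← integral_sub hib hia,
    integral_pos_iff_support_of_nonneg_ae (hlt.mono fun _ => le_of_lt) (hib.sub hia),
    pos_iff_ne_zero]
  intro h
  obtain ⟨ω, hω, hω'⟩ := (hlt.and (measure_eq_zero_iff_ae_notMem.1 h)).exists
  exact hω' hω.ne'

variable [IsProbabilityMeasure μ]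

lemma integral_log_one_add_mul_le (hX : Integrable X μ) (hpos : ∀ᵐ ω ∂μ, 0 ≤ X ω) {c : ℝ}
    (hXc : ∫ ω, X ω ∂μ ≤ c) {a : ℝ} (ha : 0 ≤ a) :
    ∫ ω, Real.log (1 + a * X ω) ∂μ ≤ Real.log (1 + a * c) := by
  have hcont : ContinuousOn (fun x => Real.log (1 + a * x)) (Set.Ici 0) :=
    ContinuousOn.log (by fun_prop) fun x (hx : 0 ≤ x) => by positivity
  have hmean : 0 ≤ ∫ ω, X ω ∂μ := integral_nonneg_of_ae hpos
  refine ((concaveOn_log_one_add_mul ha).le_map_integral hcont isClosed_Ici hpos hX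
    (integrable_log_one_add_mul hX hpos ha)).trans (Real.log_le_log (by positivity) (by gcongr))

lemma le_integral_log_one_add_mul (hX : Integrable X μ) (hpos : ∀ᵐ ω ∂μ, 0 < X ω)
    (hXi : Integrable (fun ω => (X ω)⁻¹) μ) {c : ℝ} (hc : 0 < c) (hXc : ∫ ω, (X ω)⁻¹ ∂μ ≤ c)
    {a : ℝ} (ha : 0 ≤ a) : Real.log (1 + a / c) ≤ ∫ ω, Real.log (1 + a * X ω) ∂μ := by
  have hint : Integrable (fun ω => a / (c * (c + a)) * ((X ω)⁻¹ - c)) μ :=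
    (hXi.sub (integrable_const _)).const_mul _
  have hslope : a / (c * (c + a)) * (∫ ω, (X ω)⁻¹ ∂μ - c) ≤ 0 :=
    mul_nonpos_of_nonneg_of_nonpos (by positivity) (sub_nonpos.2 hXc)
  calc Real.log (1 + a / c)
      ≤ Real.log (1 + a / c) - a / (c * (c + a)) * (∫ ω, (X ω)⁻¹ ∂μ - c) := by linarith
    _ = ∫ ω, (Real.log (1 + a / c) - a / (c * (c + a)) * ((X ω)⁻¹ - c)) ∂μ := by
        rw [integral_sub (integrable_const _) hint, integral_const_mul,
          integral_sub hXi (integrable_const _)]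
        simp
    _ ≤ ∫ ω, Real.log (1 + a * X ω) ∂μ := by
        refine integral_mono_ae ((integrable_const _).sub hint)
          (integrable_log_one_add_mul hX (hpos.mono fun _ => le_of_lt) ha) ?_
        filter_upwards [hpos] with ω hω
        simpa only [div_inv_eq_mul] using log_one_add_div_sub_le ha hc (inv_pos.2 hω)

end ExpectedLog

section MaxMin

variable {ι : Type*} {κ : ι → Type*} [∀ u, Fintype (κ u)] {g : ∀ u, κ u → ℝ → ℝ}

/-- The ways of spending at most the budget `B` on a finite family of users `u`, the user `u`
spreading its share over the streams `κ u`. -/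
def allocations [Fintype ι] (κ : ι → Type*) [∀ u, Fintype (κ u)] (B : ℝ) :
    Set (∀ u, κ u → ℝ) :=
  {P | (∀ u q, 0 ≤ P u q) ∧ ∑ u, ∑ q, P u q ≤ B}

lemma isCompact_allocations [Fintype ι] (B : ℝ) : IsCompact (allocations κ B) := by
  refine (isCompact_Icc (a := (0 : ∀ u, κ u → ℝ)) (b := fun _ _ => B)).of_isClosed_subset ?_ ?_
  · refine (isClosed_Ici (a := (0 : ∀ u, κ u → ℝ))).inter
      (isClosed_le (f := fun P : ∀ u, κ u → ℝ => ∑ u, ∑ q, P u q) ?_ continuous_const)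
    fun_prop
  · rintro P ⟨hP, hPB⟩
    refine ⟨fun u q => hP u q, fun u q => le_trans ?_ hPB⟩
    exact (Finset.single_le_sum (fun q _ => hP u q) (Finset.mem_univ q)).trans
      (Finset.single_le_sum (f := fun u => ∑ q, P u q)
        (fun u _ => Finset.sum_nonneg fun q _ => hP u q) (Finset.mem_univ u))

lemma exists_isMaxOn_iInf_sum [Fintype ι] [Nonempty ι]
    (hg : ∀ u q, ContinuousOn (g u q) (Set.Ici 0)) {B : ℝ} (hB : 0 ≤ B) :
    ∃ P ∈ allocations κ B, IsMaxOn (fun P => ⨅ u, ∑ q, g u q (P u q)) (allocations κ B) P := by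
  refine (isCompact_allocations B).exists_isMaxOn ⟨0, by simpa [allocations] using hB⟩ ?_
  simp_rw [← Finset.inf'_univ_eq_ciInf]
  refine ContinuousOn.finset_inf'_apply _ fun u _ => continuousOn_finsetSum _ fun q _ => ?_
  exact (hg u q).comp (f := fun P : ∀ u, κ u → ℝ => P u q) (by fun_prop) fun P hP => hP.1 u q

lemma exists_sum_lt_of_lt_sum {σ : Type*} [Fintype σ] {f : σ → ℝ → ℝ}
    (hf : ∀ q, ContinuousOn (f q) (Set.Ici 0)) {x : σ → ℝ} (hx : ∀ q, 0 ≤ x q) {m : ℝ}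
    (hm₀ : ∑ q, f q 0 ≤ m) (hm : m < ∑ q, f q (x q)) :
    ∃ y : σ → ℝ, (∀ q, 0 ≤ y q) ∧ ∑ q, y q < ∑ q, x q ∧ ∑ q, f q (y q) = m := by
  have hcont : ContinuousOn (fun t : ℝ => ∑ q, f q (t * x q)) (Set.Icc 0 1) :=
    continuousOn_finsetSum _ fun q _ => (hf q).comp (f := fun t : ℝ => t * x q) (by fun_prop)
      fun t ht => mul_nonneg ht.1 (hx q)
  obtain ⟨t, ⟨ht₀, ht₁⟩, rfl⟩ := intermediate_value_Icc zero_le_one hcont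
    (show m ∈ Set.Icc _ _ by simpa using ⟨hm₀, hm.le⟩)
  have hx_pos : 0 < ∑ q, x q := by
    refine (Finset.sum_nonneg fun q _ => hx q).lt_of_ne fun h => hm₀.not_gt ?_
    have hx0 : ∀ q, x q = 0 := fun q =>
      (Finset.sum_eq_zero_iff_of_nonneg fun q _ => hx q).1 h.symm q (Finset.mem_univ q)
    simp [hx0] at hm
  have ht : t < 1 := ht₁.lt_of_ne fun h => by simp [h] at hm
  refine ⟨fun q => t * x q, fun q => mul_nonneg ht₀ (hx q), ?_, rfl⟩
  rw [← Finset.mul_sum]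
  exact mul_lt_of_lt_one_left hx_pos ht

variable [Fintype ι] [Nonempty ι] [∀ u, Nonempty (κ u)]

lemma exists_mem_allocations_lt_iInf_sum (hmono : ∀ u q, StrictMonoOn (g u q) (Set.Ici 0))
    {B m : ℝ} {P : ∀ u, κ u → ℝ} (hP : ∀ u q, 0 ≤ P u q) (hPB : ∑ u, ∑ q, P u q < B)
    (hm : ∀ u, m ≤ ∑ q, g u q (P u q)) :
    ∃ P' ∈ allocations κ B, m < ⨅ u, ∑ q, g u q (P' u q) := by
  set N : ℝ := ∑ u, (Fintype.card (κ u) : ℝ)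
  have hN : 0 < N :=
    Finset.sum_pos (fun u _ => by exact_mod_cast Fintype.card_pos) Finset.univ_nonempty
  set δ := (B - ∑ u, ∑ q, P u q) / N
  have hδ : 0 < δ := div_pos (sub_pos.2 hPB) hN
  have hPδ : ∀ u q, 0 ≤ P u q + δ := fun u q => add_nonneg (hP u q) hδ.le
  refine ⟨fun u q => P u q + δ, ⟨hPδ, le_of_eq ?_⟩, ?_⟩
  · simp only [Finset.sum_add_distrib, Finset.sum_const, Finset.card_univ, nsmul_eq_mul,
      ← Finset.sum_mul]
    rw [show ∑ u, (Fintype.card (κ u) : ℝ) = N from rfl, mul_div_cancel₀ _ hN.ne', add_sub_cancel]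
  · obtain ⟨u, hu⟩ := exists_eq_ciInf_of_finite (f := fun u => ∑ q, g u q (P u q + δ))
    rw [← hu]
    exact (hm u).trans_lt (Finset.sum_lt_sum_of_nonempty Finset.univ_nonempty fun q _ =>
      hmono u q (hP u q) (hPδ u q) (lt_add_of_pos_right _ hδ))

lemma sum_eq_iInf_of_isMaxOn (hg : ∀ u q, ContinuousOn (g u q) (Set.Ici 0))
    (hmono : ∀ u q, StrictMonoOn (g u q) (Set.Ici 0)) (hg₀ : ∀ u q, g u q 0 = 0) {B : ℝ}
    {P : ∀ u, κ u → ℝ} (hP : P ∈ allocations κ B)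
    (hmax : IsMaxOn (fun P => ⨅ u, ∑ q, g u q (P u q)) (allocations κ B) P) (u : ι) :
    ∑ q, g u q (P u q) = ⨅ u, ∑ q, g u q (P u q) := by
  classical
  set m := ⨅ u, ∑ q, g u q (P u q)
  have hm : ∀ v, m ≤ ∑ q, g v q (P v q) := ciInf_le (Set.finite_range _).bddBelow
  have hm₀ : 0 ≤ m := le_ciInf fun v => Finset.sum_nonneg fun q _ =>
    (hg₀ v q).ge.trans ((hmono v q).monotoneOn Set.self_mem_Ici (hP.1 v q) (hP.1 v q))
  by_contra! hne
  obtain ⟨y, hy, hyP, hym⟩ := exists_sum_lt_of_lt_sum (hg u) (hP.1 u) (m := m)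
    (by simpa [hg₀] using hm₀) ((hm u).lt_of_ne hne.symm)
  have hPy : ∀ v, (∀ q, 0 ≤ Function.update P u y v q) ∧
      ∑ q, Function.update P u y v q ≤ ∑ q, P v q ∧
      m ≤ ∑ q, g v q (Function.update P u y v q) := by
    intro v
    rcases eq_or_ne v u with rfl | hv
    · simpa using ⟨hy, hyP.le, hym.ge⟩
    · simpa [hv] using ⟨hP.1 v, hm v⟩
  obtain ⟨P', hP', hlt⟩ := exists_mem_allocations_lt_iInf_sum hmono (fun v => (hPy v).1)
    ((Finset.sum_lt_sum (fun v _ => (hPy v).2.1)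
      ⟨u, Finset.mem_univ u, by simpa using hyP⟩).trans_le hP.2) fun v => (hPy v).2.2
  exact (hmax hP').not_gt hlt

end MaxMin

section SumExp

variable {ι : Type*} [Fintype ι] [Nonempty ι] {c d : ι → ℝ}

lemma strictMono_sum_mul_exp_sub_one (hc : ∀ u, 0 < c u) (hd : ∀ u, 0 < d u) :
    StrictMono fun R => ∑ u, c u * (Real.exp (R / d u) - 1) := fun _ _ h =>
  Finset.sum_lt_sum_of_nonempty Finset.univ_nonempty fun u _ =>
    mul_lt_mul_of_pos_left
      (sub_lt_sub_right (Real.exp_lt_exp.2 (div_lt_div_of_pos_right h (hd u))) _) (hc u)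

lemma exists_nonneg_sum_mul_exp_sub_one_eq (hc : ∀ u, 0 < c u) (hd : ∀ u, 0 < d u) {B : ℝ}
    (hB : 0 ≤ B) : ∃ R, 0 ≤ R ∧ ∑ u, c u * (Real.exp (R / d u) - 1) = B := by
  have hterm : ∀ R u, c u * (R / d u) ≤ c u * (Real.exp (R / d u) - 1) := fun R u =>
    mul_le_mul_of_nonneg_left (le_sub_iff_add_le.2 (Real.add_one_le_exp _)) (hc u).le
  obtain ⟨u₀⟩ := ‹Nonempty ι›
  have hc₀ := hc u₀
  have hd₀ := hd u₀
  set R₀ := B * d u₀ / c u₀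
  have hR₀ : 0 ≤ R₀ := by positivity
  have hBR₀ : B ≤ ∑ u, c u * (Real.exp (R₀ / d u) - 1) := by
    calc B = c u₀ * (R₀ / d u₀) := by simp only [R₀]; field_simp
      _ ≤ c u₀ * (Real.exp (R₀ / d u₀) - 1) := hterm R₀ u₀
      _ ≤ ∑ u, c u * (Real.exp (R₀ / d u) - 1) :=
        Finset.single_le_sum (f := fun u => c u * (Real.exp (R₀ / d u) - 1))
          (fun u _ => (mul_nonneg (hc u).le (div_nonneg hR₀ (hd u).le)).trans (hterm R₀ u))
          (Finset.mem_univ u₀)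
  obtain ⟨R, hR, hRB⟩ := intermediate_value_Icc hR₀
    (f := fun R => ∑ u, c u * (Real.exp (R / d u) - 1)) (by fun_prop)
    (show B ∈ Set.Icc _ _ from ⟨by simpa using hB, hBR₀⟩)
  exact ⟨R, hR.1, hRB⟩

end SumExp

namespace VCCParams

section ZeroForcing

variable {Ψ : Type*} (p : VCCParams Ψ)

/-- The column of the group channel matrix `H_ψ` that belongs to a stream. -/
def streamVec (h : p.Channel) (ψ : Ψ) (s : p.Stream ψ) : EuclideanSpace ℂ (Fin p.L) :=
  WithLp.toLp 2 fun i => h ψ s.1 i s.2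

/-- The power gain of a stream under zero-forcing (see `sinr_eq`): the squared distance of its
channel vector to the span of the channel vectors of the other streams of its group. -/
def zfGain (h : p.Channel) (ψ : Ψ) (s : p.Stream ψ) : ℝ :=
  Metric.infDist (p.streamVec h ψ s) (spanOthers ℂ (p.streamVec h ψ) s) ^ 2

variable {p} {h : p.Channel} {ψ : Ψ}

lemma zfGain_nonneg (s : p.Stream ψ) : 0 ≤ p.zfGain h ψ s := sq_nonneg _

variable (p) in
lemma card_stream (ψ : Ψ) : Fintype.card (p.Stream ψ) = p.Mgrp ψ := by
  simp [Mgrp, Fintype.card_sigma]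

lemma transpose_groupChannel_mul_map_star :
    (p.groupChannel h ψ)ᵀ * (p.groupChannel h ψ).map star =
      (Matrix.gram ℂ (p.streamVec h ψ))ᵀ := by
  ext i j
  simp [Matrix.mul_apply, groupChannel, streamVec, PiLp.inner_apply]

lemma gramInv_apply_self (hli : LinearIndependent ℂ (p.streamVec h ψ)) (s : p.Stream ψ) :
    p.gramInv h ψ s s = ((p.zfGain h ψ s)⁻¹ : ℝ) := by
  rw [gramInv, transpose_groupChannel_mul_map_star, ← Matrix.transpose_nonsing_inv,
    Matrix.transpose_apply, gram_inv_apply_self hli, zfGain]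
  simp

lemma effChannel_eq_diagonal (hli : LinearIndependent ℂ (p.streamVec h ψ)) :
    p.effChannel h ψ = Matrix.diagonal fun s => (√(p.zfGain h ψ s) : ℂ) := by
  have hdet : IsUnit ((p.groupChannel h ψ)ᵀ * (p.groupChannel h ψ).map star).det := by
    rw [transpose_groupChannel_mul_map_star, Matrix.det_transpose]
    exact isUnit_iff_ne_zero.2 (Matrix.det_gram_ne_zero_iff_linearIndependent.2 hli)
  have hpull : p.effChannel h ψ =
      ((p.groupChannel h ψ)ᵀ * ((p.groupChannel h ψ).map star * p.gramInv h ψ)) *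
        Matrix.diagonal fun s => (((√(p.gramInv h ψ s s).re)⁻¹ : ℝ) : ℂ) := by
    ext s s'
    rw [Matrix.mul_diagonal, effChannel, Matrix.mul_apply, Matrix.mul_apply, Finset.sum_mul]
    exact Finset.sum_congr rfl fun i _ => (mul_assoc _ _ _).symm
  rw [hpull, ← Matrix.mul_assoc, gramInv, Matrix.mul_nonsing_inv _ hdet, ← gramInv,
    Matrix.one_mul]
  simp only [gramInv_apply_self hli, Complex.ofReal_re, Real.sqrt_inv, inv_inv]

lemma sinr_eq (hli : LinearIndependent ℂ (p.streamVec h ψ)) (P : p.Power) (s : p.Stream ψ) :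
    p.sinr P h ψ s = P ψ s.1 s.2 / p.N₀ * p.zfGain h ψ s := by
  have hinterference : ∑ s' ∈ Finset.univ.erase s,
      P ψ s'.1 s'.2 * ‖p.effChannel h ψ s s'‖ ^ 2 = 0 := by
    refine Finset.sum_eq_zero fun s' hs' => ?_
    rw [effChannel_eq_diagonal hli, Matrix.diagonal_apply_ne' _ (Finset.ne_of_mem_erase hs')]
    simp
  rw [sinr, hinterference, effChannel_eq_diagonal hli, Matrix.diagonal_apply_eq, Complex.norm_real,
    Real.norm_eq_abs, sq_abs, Real.sq_sqrt (zfGain_nonneg s), add_zero, div_mul_eq_mul_div]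

end ZeroForcing

section Rayleigh

variable {Ψ : Type*} {p : VCCParams Ψ} {Ω : Type*} [MeasurableSpace Ω] {μ : Measure Ω}
  {H : Ω → p.Channel}

/-- Rayleigh fading with the laws of `IsRayleigh`, but with independence required only between the
channel coefficients of the same group; a stream is not affected by the channels of the other
groups. -/
structure IsGroupwiseRayleigh (p : VCCParams Ψ) (μ : Measure Ω) (H : Ω → p.Channel) : Prop where
  law : ∀ ψ k i q, HasLaw (fun ω => H ω ψ k i q) (complexGaussian (p.β ψ k)) μ
  indep : ∀ ψ, iIndepFun
    (fun (c : (k : Fin p.Q) × Fin p.L × Fin (p.M ψ k)) ω => H ω ψ c.1 c.2.1 c.2.2) μ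

lemma IsRayleigh.isGroupwiseRayleigh (hH : p.IsRayleigh μ H) : p.IsGroupwiseRayleigh μ H where
  law := hH.law
  indep ψ := hH.indep.precomp (g := fun c => ⟨ψ, c⟩)
    fun _ _ h => by simpa using h

namespace IsGroupwiseRayleigh

lemma aemeasurable (hH : p.IsGroupwiseRayleigh μ H) (ψ : Ψ) (s : p.Stream ψ) (i : Fin p.L) :
    AEMeasurable (fun ω => H ω ψ s.1 i s.2) μ :=
  (hH.law ψ s.1 i s.2).aemeasurable

lemma iIndepFun_stream (hH : p.IsGroupwiseRayleigh μ H) (ψ : Ψ) :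
    iIndepFun (fun (x : p.Stream ψ × Fin p.L) ω => H ω ψ x.1.1 x.2 x.1.2) μ := by
  refine (hH.indep ψ).precomp (g := fun x : p.Stream ψ × Fin p.L => ⟨x.1.1, x.2, x.1.2⟩) ?_
  rintro ⟨⟨k, q⟩, i⟩ ⟨⟨k', q'⟩, i'⟩ h
  obtain ⟨rfl, h⟩ := Sigma.mk.inj h
  obtain ⟨rfl, rfl⟩ := Prod.mk.inj (eq_of_heq h)
  rfl

lemma indepFun_streamVec (hH : p.IsGroupwiseRayleigh μ H) (ψ : Ψ) (s : p.Stream ψ) :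
    IndepFun (fun ω (j : {j // j ≠ s}) => p.streamVec (H ω) ψ j)
      (fun ω => p.streamVec (H ω) ψ s) μ := by
  classical
  have hindep := (hH.iIndepFun_stream ψ).indepFun_finset₀
    (Finset.univ.filter fun x => x.1 ≠ s) (Finset.univ.filter fun x => x.1 = s)
    (Finset.disjoint_filter.2 fun _ _ hne => hne) fun x => hH.aemeasurable ψ x.1 x.2
  exact hindep.comp
    (φ := fun f (j : {j // j ≠ s}) => WithLp.toLp 2 fun i =>
      f ⟨(j, i), Finset.mem_filter.2 ⟨Finset.mem_univ _, j.2⟩⟩)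
    (ψ := fun f => WithLp.toLp 2 fun i =>
      f ⟨(s, i), Finset.mem_filter.2 ⟨Finset.mem_univ _, rfl⟩⟩)
    (measurable_pi_lambda _ fun j => by fun_prop) (by fun_prop)

variable [IsProbabilityMeasure μ]

lemma hasLaw_streamVec (hH : p.IsGroupwiseRayleigh μ H) {ψ : Ψ} {s : p.Stream ψ}
    (hβ : 0 ≤ p.β ψ s.1) :
    HasLaw (fun ω => p.streamVec (H ω) ψ s)
      (isotropicGaussian (EuclideanSpace ℂ (Fin p.L)) (p.β ψ s.1 / 2)) μ where
  aemeasurable := (WithLp.measurable_toLp 2 _).comp_aemeasurable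
    (aemeasurable_pi_lambda _ (hH.aemeasurable ψ s))
  map_eq := by
    have hjoint : μ.map (fun ω i => H ω ψ s.1 i s.2) =
        Measure.pi fun _ => isotropicGaussian ℂ (p.β ψ s.1 / 2) := by
      rw [(iIndepFun_iff_map_fun_eq_pi_map (hH.aemeasurable ψ s)).1
        ((hH.iIndepFun_stream ψ).precomp (Prod.mk_right_injective s))]
      simp only [(hH.law ψ s.1 _ s.2).map_eq, complexGaussian_eq_isotropicGaussian hβ]
    rw [← map_pi_isotropicGaussian (by positivity), ← hjoint,
      AEMeasurable.map_map_of_aemeasurable (by fun_prop)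
        (aemeasurable_pi_lambda _ (hH.aemeasurable ψ s))]
    rfl

lemma isGaussianFamily (hH : p.IsGroupwiseRayleigh μ H) {ψ : Ψ} (hβ : ∀ k, 0 ≤ p.β ψ k) :
    IsGaussianFamily μ (fun ω => p.streamVec (H ω) ψ) fun s => p.β ψ s.1 where
  law s := hH.hasLaw_streamVec (hβ s.1)
  indep := hH.indepFun_streamVec ψ

end IsGroupwiseRayleigh

end Rayleigh

namespace IsGroupwiseRayleigh

variable {Ψ : Type*} {p : VCCParams Ψ} {Ω : Type*} [MeasurableSpace Ω] {μ : Measure Ω}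
  [IsProbabilityMeasure μ] {H : Ω → p.Channel} {ψ : Ψ}

section Gain

lemma ae_linearIndependent_streamVec (hH : p.IsGroupwiseRayleigh μ H)
    (hβ : ∀ k, 0 < p.β ψ k) (hL : p.Mgrp ψ < p.L) :
    ∀ᵐ ω ∂μ, LinearIndependent ℂ (p.streamVec (H ω) ψ) :=
  (hH.isGaussianFamily fun k => (hβ k).le).ae_linearIndependent (fun _ => hβ _)
    (by rwa [card_stream, finrank_euclideanSpace_fin])

lemma ae_zfGain_pos (hH : p.IsGroupwiseRayleigh μ H) (hβ : ∀ k, 0 < p.β ψ k)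
    (hL : p.Mgrp ψ < p.L) (s : p.Stream ψ) : ∀ᵐ ω ∂μ, 0 < p.zfGain (H ω) ψ s :=
  ((hH.isGaussianFamily fun k => (hβ k).le).ae_infDist_pos (hβ s.1)
    (by rwa [card_stream, finrank_euclideanSpace_fin])).mono fun _ h => pow_pos h 2

lemma aemeasurable_zfGain (hH : p.IsGroupwiseRayleigh μ H) (hβ : ∀ k, 0 ≤ p.β ψ k)
    (s : p.Stream ψ) : AEMeasurable (fun ω => p.zfGain (H ω) ψ s) μ :=
  ((hH.isGaussianFamily hβ).aemeasurable_infDist s).pow_const 2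

lemma lintegral_zfGain (hH : p.IsGroupwiseRayleigh μ H) (hβ : ∀ k, 0 < p.β ψ k)
    (hL : p.Mgrp ψ < p.L) (s : p.Stream ψ) :
    ∫⁻ ω, ENNReal.ofReal (p.zfGain (H ω) ψ s) ∂μ =
      ENNReal.ofReal (p.β ψ s.1 * (p.L - p.Mgrp ψ + 1)) := by
  have h := (hH.isGaussianFamily fun k => (hβ k).le).lintegral_infDist_sq (fun _ => hβ _)
    (by rwa [card_stream, finrank_euclideanSpace_fin]) s
  rwa [card_stream, finrank_euclideanSpace_fin] at h

lemma lintegral_inv_zfGain_le (hH : p.IsGroupwiseRayleigh μ H) (hβ : ∀ k, 0 < p.β ψ k)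
    (hL : p.Mgrp ψ < p.L) (s : p.Stream ψ) :
    ∫⁻ ω, ENNReal.ofReal (p.zfGain (H ω) ψ s)⁻¹ ∂μ ≤
      ENNReal.ofReal (p.β ψ s.1 * (p.L - p.Mgrp ψ))⁻¹ := by
  have h := (hH.isGaussianFamily fun k => (hβ k).le).lintegral_inv_infDist_sq_le (hβ s.1)
    (by rwa [card_stream, finrank_euclideanSpace_fin])
  rw [card_stream, finrank_euclideanSpace_fin] at h
  refine (lintegral_congr_ae ?_).trans_le h
  filter_upwards [hH.ae_zfGain_pos hβ hL s] with ω hω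
  exact ENNReal.ofReal_inv_of_pos hω

lemma integrable_zfGain (hH : p.IsGroupwiseRayleigh μ H) (hβ : ∀ k, 0 < p.β ψ k)
    (hL : p.Mgrp ψ < p.L) (s : p.Stream ψ) : Integrable (fun ω => p.zfGain (H ω) ψ s) μ :=
  integrable_of_lintegral_ofReal_le (hH.aemeasurable_zfGain (fun k => (hβ k).le) s)
    (.of_forall fun _ => zfGain_nonneg s) (hH.lintegral_zfGain hβ hL s).le

lemma integrable_log_one_add_mul_zfGain (hH : p.IsGroupwiseRayleigh μ H)
    (hβ : ∀ k, 0 < p.β ψ k) (hL : p.Mgrp ψ < p.L) (s : p.Stream ψ) {a : ℝ} (ha : 0 ≤ a) :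
    Integrable (fun ω => Real.log (1 + a * p.zfGain (H ω) ψ s)) μ :=
  integrable_log_one_add_mul (hH.integrable_zfGain hβ hL s)
    (.of_forall fun _ => zfGain_nonneg s) ha

lemma integral_log_one_add_mul_zfGain_le (hH : p.IsGroupwiseRayleigh μ H)
    (hβ : ∀ k, 0 < p.β ψ k) (hL : p.Mgrp ψ < p.L) (s : p.Stream ψ) {a : ℝ} (ha : 0 ≤ a) :
    ∫ ω, Real.log (1 + a * p.zfGain (H ω) ψ s) ∂μ ≤
      Real.log (1 + a * (p.β ψ s.1 * (p.L - p.Mgrp ψ + 1))) := by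
  have hL' : (p.Mgrp ψ : ℝ) < p.L := by exact_mod_cast hL
  have hpos : ∀ᵐ ω ∂μ, 0 ≤ p.zfGain (H ω) ψ s := .of_forall fun _ => zfGain_nonneg s
  exact integral_log_one_add_mul_le (hH.integrable_zfGain hβ hL s) hpos
    (integral_le_of_lintegral_ofReal_le (mul_nonneg (hβ _).le (by linarith))
      (hH.aemeasurable_zfGain (fun k => (hβ k).le) s) hpos (hH.lintegral_zfGain hβ hL s).le) ha

lemma le_integral_log_one_add_mul_zfGain (hH : p.IsGroupwiseRayleigh μ H)
    (hβ : ∀ k, 0 < p.β ψ k) (hL : p.Mgrp ψ < p.L) (s : p.Stream ψ) {a : ℝ} (ha : 0 ≤ a) :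
    Real.log (1 + a * (p.β ψ s.1 * (p.L - p.Mgrp ψ))) ≤
      ∫ ω, Real.log (1 + a * p.zfGain (H ω) ψ s) ∂μ := by
  have hL' : (p.Mgrp ψ : ℝ) < p.L := by exact_mod_cast hL
  have hc : 0 < (p.β ψ s.1 * (p.L - p.Mgrp ψ))⁻¹ :=
    inv_pos.2 (mul_pos (hβ _) (sub_pos.2 hL'))
  have hpos : ∀ᵐ ω ∂μ, 0 ≤ (p.zfGain (H ω) ψ s)⁻¹ :=
    .of_forall fun _ => inv_nonneg.2 (zfGain_nonneg s)
  have hmeas := (hH.aemeasurable_zfGain (fun k => (hβ k).le) s).inv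
  have hmean := hH.lintegral_inv_zfGain_le hβ hL s
  simpa only [div_inv_eq_mul] using le_integral_log_one_add_mul (hH.integrable_zfGain hβ hL s)
    (hH.ae_zfGain_pos hβ hL s) (integrable_of_lintegral_ofReal_le hmeas hpos hmean) hc
    (integral_le_of_lintegral_ofReal_le hc.le hmeas hpos hmean) ha

end Gain

end IsGroupwiseRayleigh

section Rates

variable {Ψ : Type*} [Fintype Ψ] {p : VCCParams Ψ} {Ω : Type*} [MeasurableSpace Ω]
  {μ : Measure Ω} {H : Ω → p.Channel} {ψ : Ψ}

/-- The fading-averaged effective rate of a stream that is sent with power `x`. -/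
def streamRate (μ : Measure Ω) (H : Ω → p.Channel) (ψ : Ψ) (s : p.Stream ψ) (x : ℝ) : ℝ :=
  p.ξ * ∫ ω, Real.log (1 + x / p.N₀ * p.zfGain (H ω) ψ s) ∂μ

lemma streamRate_zero (s : p.Stream ψ) : streamRate μ H ψ s 0 = 0 := by
  simp [streamRate]

namespace IsGroupwiseRayleigh

variable [IsProbabilityMeasure μ]

lemma continuousOn_streamRate (hH : p.IsGroupwiseRayleigh μ H) (hβ : ∀ k, 0 < p.β ψ k)
    (hL : p.Mgrp ψ < p.L) (hN : 0 ≤ p.N₀) (s : p.Stream ψ) :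
    ContinuousOn (streamRate μ H ψ s) (Set.Ici 0) :=
  continuousOn_const.mul <| (continuousOn_integral_log_one_add_mul
    (hH.integrable_zfGain hβ hL s) (.of_forall fun _ => zfGain_nonneg s)).comp
    (f := fun x : ℝ => x / p.N₀) (by fun_prop) fun _ hx => div_nonneg hx hN

lemma strictMonoOn_streamRate (hH : p.IsGroupwiseRayleigh μ H) (hβ : ∀ k, 0 < p.β ψ k)
    (hL : p.Mgrp ψ < p.L) (hN : 0 < p.N₀) (hξ : 0 < p.ξ) (s : p.Stream ψ) :
    StrictMonoOn (streamRate μ H ψ s) (Set.Ici 0) := fun _ hx _ hy h =>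
  mul_lt_mul_of_pos_left (strictMonoOn_integral_log_one_add_mul (hH.integrable_zfGain hβ hL s)
    (hH.ae_zfGain_pos hβ hL s) (div_nonneg hx hN.le) (div_nonneg hy hN.le)
    (div_lt_div_of_pos_right h hN)) hξ

lemma userRate_ae_eq (hH : p.IsGroupwiseRayleigh μ H) (hβ : ∀ k, 0 < p.β ψ k)
    (hL : p.Mgrp ψ < p.L) (P : p.Power) (k : Fin p.Q) :
    (fun ω => p.userRate P (H ω) ψ k) =ᵐ[μ] fun ω =>
      p.ξ * ∑ q, Real.log (1 + P ψ k q / p.N₀ * p.zfGain (H ω) ψ ⟨k, q⟩) := by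
  filter_upwards [hH.ae_linearIndependent_streamVec hβ hL] with ω hω
  simp only [userRate, sinr_eq hω]

lemma integrable_userRate (hH : p.IsGroupwiseRayleigh μ H) (hβ : ∀ k, 0 < p.β ψ k)
    (hL : p.Mgrp ψ < p.L) (hN : 0 ≤ p.N₀) {P : p.Power} (k : Fin p.Q)
    (hP : ∀ q, 0 ≤ P ψ k q) : Integrable (fun ω => p.userRate P (H ω) ψ k) μ :=
  (integrable_congr (hH.userRate_ae_eq hβ hL P k)).2 <| .const_mul
    (integrable_finsetSum _ fun q _ =>
      hH.integrable_log_one_add_mul_zfGain hβ hL _ (div_nonneg (hP q) hN)) _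

lemma avgUserRate_eq_sum_streamRate (hH : p.IsGroupwiseRayleigh μ H) (hβ : ∀ k, 0 < p.β ψ k)
    (hL : p.Mgrp ψ < p.L) (hN : 0 ≤ p.N₀) {P : p.Power} (k : Fin p.Q)
    (hP : ∀ q, 0 ≤ P ψ k q) :
    p.avgUserRate μ H P ψ k = ∑ q, streamRate μ H ψ ⟨k, q⟩ (P ψ k q) := by
  rw [avgUserRate, integral_congr_ae (hH.userRate_ae_eq hβ hL P k), integral_const_mul,
    integral_finsetSum _ fun q _ =>
      hH.integrable_log_one_add_mul_zfGain hβ hL _ (div_nonneg (hP q) hN), Finset.mul_sum]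
  rfl

lemma avgUserRate_le (hH : p.IsGroupwiseRayleigh μ H) (hβ : ∀ k, 0 < p.β ψ k)
    (hL : p.Mgrp ψ < p.L) (hN : 0 ≤ p.N₀) (hξ : 0 ≤ p.ξ) {P : p.Power} {k : Fin p.Q}
    (hM : 0 < p.M ψ k) (hP : ∀ q, 0 ≤ P ψ k q) :
    p.avgUserRate μ H P ψ k ≤ p.ξ * (p.M ψ k * Real.log
      (1 + p.β ψ k * (p.L - p.Mgrp ψ + 1) / p.N₀ * ((∑ q, P ψ k q) / p.M ψ k))) := by
  have : Nonempty (Fin (p.M ψ k)) := ⟨⟨0, hM⟩⟩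
  have hL' : (p.Mgrp ψ : ℝ) < p.L := by exact_mod_cast hL
  have hgain : 0 ≤ p.β ψ k * (p.L - p.Mgrp ψ + 1) / p.N₀ :=
    div_nonneg (mul_nonneg (hβ k).le (by linarith)) hN
  have hJensen := sum_log_one_add_mul_le hgain hP
  rw [Fintype.card_fin] at hJensen
  rw [hH.avgUserRate_eq_sum_streamRate hβ hL hN k hP]
  simp only [streamRate, ← Finset.mul_sum]
  refine mul_le_mul_of_nonneg_left (le_trans (Finset.sum_le_sum fun q _ => ?_) hJensen) hξ
  rw [div_mul_comm]
  exact hH.integral_log_one_add_mul_zfGain_le hβ hL ⟨k, q⟩ (div_nonneg (hP q) hN)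

lemma le_avgUserRate (hH : p.IsGroupwiseRayleigh μ H) (hβ : ∀ k, 0 < p.β ψ k)
    (hL : p.Mgrp ψ < p.L) (hN : 0 ≤ p.N₀) (hξ : 0 ≤ p.ξ) {P : p.Power} (k : Fin p.Q)
    (hP : ∀ q, 0 ≤ P ψ k q) :
    p.ξ * ∑ q, Real.log (1 + P ψ k q / p.N₀ * (p.β ψ k * (p.L - p.Mgrp ψ))) ≤
      p.avgUserRate μ H P ψ k := by
  rw [hH.avgUserRate_eq_sum_streamRate hβ hL hN k hP]
  simp only [streamRate, ← Finset.mul_sum]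
  exact mul_le_mul_of_nonneg_left (Finset.sum_le_sum fun q _ =>
    hH.le_integral_log_one_add_mul_zfGain hβ hL ⟨k, q⟩ (div_nonneg (hP q) hN)) hξ

end IsGroupwiseRayleigh

end Rates

section RequiredPower

variable {Ψ : Type*} [Fintype Ψ] {p : VCCParams Ψ} {ℓ : Ψ → ℝ}

/-- The total power that gives every user the rate `R / (G Q)` if each stream of user `k` of
group `ψ` has the deterministic gain `β_{ψ,k} ℓ_ψ`. The two bounds of the theorem are the sum
rates at which it equals `P_tot`, with `ℓ_ψ = L - M_ψ` and `ℓ_ψ = L - M_ψ + 1`. -/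
def requiredPower (p : VCCParams Ψ) (ℓ : Ψ → ℝ) (R : ℝ) : ℝ :=
  ∑ ψ, ∑ k, p.N₀ * p.M ψ k * (Real.exp (R / (p.ξ * G (Ψ := Ψ) * p.Q * p.M ψ k)) - 1) /
    (p.β ψ k * ℓ ψ)

lemma requiredPower_eq_sum_mul_exp_sub_one (p : VCCParams Ψ) (ℓ : Ψ → ℝ) :
    p.requiredPower ℓ = fun R => ∑ u : Ψ × Fin p.Q, p.N₀ * p.M u.1 u.2 / (p.β u.1 u.2 * ℓ u.1) *
      (Real.exp (R / (p.ξ * G (Ψ := Ψ) * p.Q * p.M u.1 u.2)) - 1) := by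
  funext R
  simp only [requiredPower, Fintype.sum_prod_type, mul_div_right_comm]

variable [Nonempty Ψ]

lemma strictMono_requiredPower (hQ : 0 < p.Q) (hM : ∀ ψ k, 0 < p.M ψ k)
    (hβ : ∀ ψ k, 0 < p.β ψ k) (hN : 0 < p.N₀) (hξ : 0 < p.ξ) (hℓ : ∀ ψ, 0 < ℓ ψ) :
    StrictMono (p.requiredPower ℓ) := by
  have : Nonempty (Fin p.Q) := ⟨⟨0, hQ⟩⟩
  have hG : 0 < G (Ψ := Ψ) := Fintype.card_pos
  rw [requiredPower_eq_sum_mul_exp_sub_one]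
  refine strictMono_sum_mul_exp_sub_one (fun u => ?_) fun u => ?_
  all_goals
    have := hM u.1 u.2
    have := hβ u.1 u.2
    have := hℓ u.1
    positivity

lemma exists_nonneg_requiredPower_eq_iff (hQ : 0 < p.Q) (hM : ∀ ψ k, 0 < p.M ψ k)
    (hβ : ∀ ψ k, 0 < p.β ψ k) (hN : 0 < p.N₀) (hξ : 0 < p.ξ) (hℓ : ∀ ψ, 0 < ℓ ψ) {B : ℝ}
    (hB : 0 ≤ B) : ∃ R, 0 ≤ R ∧ ∀ R', p.requiredPower ℓ R' = B ↔ R' = R := by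
  have : Nonempty (Fin p.Q) := ⟨⟨0, hQ⟩⟩
  have hG : 0 < G (Ψ := Ψ) := Fintype.card_pos
  suffices ∃ R, 0 ≤ R ∧ p.requiredPower ℓ R = B by
    obtain ⟨R, hR, rfl⟩ := this
    exact ⟨R, hR, fun _ => (strictMono_requiredPower hQ hM hβ hN hξ hℓ).injective.eq_iff⟩
  rw [requiredPower_eq_sum_mul_exp_sub_one]
  refine exists_nonneg_sum_mul_exp_sub_one_eq (fun u => ?_) (fun u => ?_) hB
  all_goals
    have := hM u.1 u.2
    have := hβ u.1 u.2
    have := hℓ u.1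
    positivity

lemma requiredPower_mul_log (hQ : 0 < p.Q) (hβ : ∀ ψ k, 0 < p.β ψ k) (hN : 0 < p.N₀)
    (hξ : 0 < p.ξ) {M : ℕ} (hM₀ : 0 < M) (hM : ∀ ψ k, p.M ψ k = M) {l : ℝ} (hl : 0 < l)
    (hℓ : ∀ ψ, ℓ ψ = l) {B : ℝ} (hB : 0 ≤ B) :
    p.requiredPower ℓ (p.ξ * G (Ψ := Ψ) * p.Q * M *
      Real.log (1 + B * l / (M * p.N₀ * ∑ ψ, ∑ k, (p.β ψ k)⁻¹))) = B := by
  have : Nonempty (Fin p.Q) := ⟨⟨0, hQ⟩⟩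
  have hG : 0 < G (Ψ := Ψ) := Fintype.card_pos
  set S := ∑ ψ, ∑ k, (p.β ψ k)⁻¹
  have hS : 0 < S :=
    Finset.sum_pos (fun ψ _ => Finset.sum_pos (fun k _ => inv_pos.2 (hβ ψ k))
      Finset.univ_nonempty) Finset.univ_nonempty
  have hterm : ∀ ψ k, p.N₀ * p.M ψ k * (Real.exp (p.ξ * G (Ψ := Ψ) * p.Q * M *
      Real.log (1 + B * l / (M * p.N₀ * S)) / (p.ξ * G (Ψ := Ψ) * p.Q * p.M ψ k)) - 1) /
        (p.β ψ k * ℓ ψ) = B / S * (p.β ψ k)⁻¹ := by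
    intro ψ k
    have := (hβ ψ k).ne'
    rw [hM, hℓ, mul_div_cancel_left₀ _ (by positivity), Real.exp_log (by positivity)]
    field_simp
    ring
  simp only [requiredPower, hterm, ← Finset.mul_sum]
  exact div_mul_cancel₀ B hS.ne'

end RequiredPower

section MaxMinFairness

variable {Ψ : Type*} [Fintype Ψ] {p : VCCParams Ψ} {Ω : Type*} [MeasurableSpace Ω]
  {μ : Measure Ω} [IsProbabilityMeasure μ] {H : Ω → p.Channel} {P : p.Power}

lemma feasible_iff_mem_allocations : p.Feasible P ↔
    (fun u : Ψ × Fin p.Q => P u.1 u.2) ∈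
      allocations (fun u : Ψ × Fin p.Q => Fin (p.M u.1 u.2)) p.Ptot := by
  rw [Feasible, allocations, Set.mem_ofPred_eq, Fintype.sum_prod_type, Prod.forall]

namespace IsGroupwiseRayleigh

lemma minAvgRate_eq (hH : p.IsGroupwiseRayleigh μ H) (hβ : ∀ ψ k, 0 < p.β ψ k)
    (hL : ∀ ψ, p.Mgrp ψ < p.L) (hN : 0 ≤ p.N₀) (hP : ∀ ψ k q, 0 ≤ P ψ k q) :
    p.minAvgRate μ H P =
      ⨅ u : Ψ × Fin p.Q, ∑ q, streamRate μ H u.1 ⟨u.2, q⟩ (P u.1 u.2 q) := by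
  simp only [minAvgRate, hH.avgUserRate_eq_sum_streamRate (hβ _) (hL _) hN _ (hP _ _)]

lemma isMMFOptimal_iff_isMaxOn (hH : p.IsGroupwiseRayleigh μ H) (hβ : ∀ ψ k, 0 < p.β ψ k)
    (hL : ∀ ψ, p.Mgrp ψ < p.L) (hN : 0 ≤ p.N₀) (hP : p.Feasible P) :
    p.IsMMFOptimal μ H P ↔
      IsMaxOn (fun P => ⨅ u : Ψ × Fin p.Q, ∑ q, streamRate μ H u.1 ⟨u.2, q⟩ (P u q))
        (allocations (fun u : Ψ × Fin p.Q => Fin (p.M u.1 u.2)) p.Ptot) fun u => P u.1 u.2 := by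
  refine ⟨fun h P' hP' => ?_, fun h => ⟨hP, fun P' hP' => ?_⟩⟩
  · have hP'' : p.Feasible fun ψ k => P' (ψ, k) := feasible_iff_mem_allocations.2 hP'
    have hle := h.2 _ hP''
    rwa [hH.minAvgRate_eq hβ hL hN hP.1, hH.minAvgRate_eq hβ hL hN hP''.1] at hle
  · rw [hH.minAvgRate_eq hβ hL hN hP.1, hH.minAvgRate_eq hβ hL hN hP'.1]
    exact h (feasible_iff_mem_allocations.1 hP')

variable [Nonempty Ψ]

lemma exists_isMMFOptimal (hH : p.IsGroupwiseRayleigh μ H) (hQ : 0 < p.Q)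
    (hβ : ∀ ψ k, 0 < p.β ψ k) (hL : ∀ ψ, p.Mgrp ψ < p.L) (hN : 0 ≤ p.N₀) (hPtot : 0 ≤ p.Ptot) :
    ∃ P, p.IsMMFOptimal μ H P := by
  have : Nonempty (Fin p.Q) := ⟨⟨0, hQ⟩⟩
  obtain ⟨P, hP, hmax⟩ := exists_isMaxOn_iInf_sum (ι := Ψ × Fin p.Q)
    (κ := fun u => Fin (p.M u.1 u.2)) (g := fun u q => streamRate μ H u.1 ⟨u.2, q⟩)
    (fun u q => hH.continuousOn_streamRate (hβ _) (hL _) hN _) hPtot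
  exact ⟨fun ψ k => P (ψ, k),
    (hH.isMMFOptimal_iff_isMaxOn hβ hL hN (feasible_iff_mem_allocations.2 hP)).2 hmax⟩

lemma avgUserRate_eq_minAvgRate (hH : p.IsGroupwiseRayleigh μ H) (hM : ∀ ψ k, 0 < p.M ψ k)
    (hβ : ∀ ψ k, 0 < p.β ψ k) (hL : ∀ ψ, p.Mgrp ψ < p.L) (hN : 0 < p.N₀) (hξ : 0 < p.ξ)
    (hP : p.IsMMFOptimal μ H P) (ψ : Ψ) (k : Fin p.Q) :
    p.avgUserRate μ H P ψ k = p.minAvgRate μ H P := by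
  have : Nonempty (Fin p.Q) := ⟨k⟩
  have : ∀ u : Ψ × Fin p.Q, Nonempty (Fin (p.M u.1 u.2)) := fun u => ⟨⟨0, hM _ _⟩⟩
  rw [hH.minAvgRate_eq hβ hL hN.le hP.1.1,
    hH.avgUserRate_eq_sum_streamRate (hβ ψ) (hL ψ) hN.le k (hP.1.1 ψ k)]
  exact sum_eq_iInf_of_isMaxOn (ι := Ψ × Fin p.Q) (κ := fun u => Fin (p.M u.1 u.2))
    (g := fun u q => streamRate μ H u.1 ⟨u.2, q⟩)
    (fun u q => hH.continuousOn_streamRate (hβ _) (hL _) hN.le _)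
    (fun u q => hH.strictMonoOn_streamRate (hβ _) (hL _) hN hξ _) (fun u q => streamRate_zero _)
    (feasible_iff_mem_allocations.1 hP.1)
    ((hH.isMMFOptimal_iff_isMaxOn hβ hL hN.le hP.1).1 hP) (ψ, k)

lemma avgSumRate_eq (hH : p.IsGroupwiseRayleigh μ H) (hM : ∀ ψ k, 0 < p.M ψ k)
    (hβ : ∀ ψ k, 0 < p.β ψ k) (hL : ∀ ψ, p.Mgrp ψ < p.L) (hN : 0 < p.N₀) (hξ : 0 < p.ξ)
    (hP : p.IsMMFOptimal μ H P) :
    p.avgSumRate μ H P = G (Ψ := Ψ) * p.Q * p.minAvgRate μ H P := by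
  simp only [avgSumRate, hH.avgUserRate_eq_minAvgRate hM hβ hL hN hξ hP, Finset.sum_const,
    Finset.card_univ, Fintype.card_fin, nsmul_eq_mul, G, mul_assoc]

lemma isMMFSumRate_iff (hH : p.IsGroupwiseRayleigh μ H) (hM : ∀ ψ k, 0 < p.M ψ k)
    (hβ : ∀ ψ k, 0 < p.β ψ k) (hL : ∀ ψ, p.Mgrp ψ < p.L) (hN : 0 < p.N₀) (hξ : 0 < p.ξ)
    (hP : p.IsMMFOptimal μ H P) {R : ℝ} : p.IsMMFSumRate μ H R ↔ R = p.avgSumRate μ H P := by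
  refine ⟨?_, fun h => ⟨P, hP, h.symm⟩⟩
  rintro ⟨P', hP', rfl⟩
  rw [hH.avgSumRate_eq hM hβ hL hN hξ hP', hH.avgSumRate_eq hM hβ hL hN hξ hP,
    (hP.2 P' hP'.1).antisymm (hP'.2 P hP.1)]

end IsGroupwiseRayleigh

end MaxMinFairness

namespace IsGroupwiseRayleigh

variable {Ψ : Type*} [Fintype Ψ] {p : VCCParams Ψ} {Ω : Type*} [MeasurableSpace Ω]
  {μ : Measure Ω} [IsProbabilityMeasure μ] {H : Ω → p.Channel} {P : p.Power}

lemma le_sum_power (hH : p.IsGroupwiseRayleigh μ H) {ψ : Ψ} {k : Fin p.Q} (hM : 0 < p.M ψ k)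
    (hβ : ∀ k, 0 < p.β ψ k) (hL : p.Mgrp ψ < p.L) (hN : 0 < p.N₀) (hξ : 0 < p.ξ)
    (hP : ∀ q, 0 ≤ P ψ k q) :
    p.N₀ * p.M ψ k * (Real.exp (p.avgUserRate μ H P ψ k / (p.ξ * p.M ψ k)) - 1) /
      (p.β ψ k * (p.L - p.Mgrp ψ + 1)) ≤ ∑ q, P ψ k q := by
  have hrate := hH.avgUserRate_le hβ hL hN.le hξ.le hM hP
  have hL' : (p.Mgrp ψ : ℝ) < p.L := by exact_mod_cast hL
  have hc : 0 < p.β ψ k * (p.L - p.Mgrp ψ + 1) := mul_pos (hβ k) (by linarith)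
  have hS : 0 ≤ ∑ q, P ψ k q := Finset.sum_nonneg fun q _ => hP q
  generalize p.β ψ k * (p.L - p.Mgrp ψ + 1) = c at hrate hc ⊢
  rw [← mul_assoc, ← div_le_iff₀' (by positivity), Real.le_log_iff_exp_le (by positivity),
    ← sub_le_iff_le_add'] at hrate
  calc p.N₀ * p.M ψ k * (Real.exp (p.avgUserRate μ H P ψ k / (p.ξ * p.M ψ k)) - 1) / c
      ≤ p.N₀ * p.M ψ k * (c / p.N₀ * ((∑ q, P ψ k q) / p.M ψ k)) / c := by gcongr
    _ = ∑ q, P ψ k q := by field_simp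

variable [Nonempty Ψ]

lemma requiredPower_avgSumRate_le (hH : p.IsGroupwiseRayleigh μ H) (hM : ∀ ψ k, 0 < p.M ψ k)
    (hβ : ∀ ψ k, 0 < p.β ψ k) (hL : ∀ ψ, p.Mgrp ψ < p.L) (hN : 0 < p.N₀) (hξ : 0 < p.ξ)
    (hP : p.IsMMFOptimal μ H P) :
    p.requiredPower (fun ψ => p.L - p.Mgrp ψ + 1) (p.avgSumRate μ H P) ≤ p.Ptot := by
  have hG : 0 < G (Ψ := Ψ) := Fintype.card_pos
  refine le_trans (Finset.sum_le_sum fun ψ _ => Finset.sum_le_sum fun k _ => ?_) hP.1.2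
  have hQ : 0 < p.Q := k.pos
  have hrate : p.avgSumRate μ H P / (p.ξ * G (Ψ := Ψ) * p.Q * p.M ψ k) =
      p.avgUserRate μ H P ψ k / (p.ξ * p.M ψ k) := by
    rw [hH.avgSumRate_eq hM hβ hL hN hξ hP, hH.avgUserRate_eq_minAvgRate hM hβ hL hN hξ hP]
    field_simp
  rw [hrate]
  exact hH.le_sum_power (hM ψ k) (hβ ψ) (hL ψ) hN hξ (hP.1.1 ψ k)

end IsGroupwiseRayleigh

/-- The allocation that spends `requiredPower ℓ R`, uniformly over the streams of each user. -/
def uniformPower {Ψ : Type*} [Fintype Ψ] (p : VCCParams Ψ) (ℓ : Ψ → ℝ) (R : ℝ) : p.Power :=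
  fun ψ k _ => p.N₀ * (Real.exp (R / (p.ξ * G (Ψ := Ψ) * p.Q * p.M ψ k)) - 1) / (p.β ψ k * ℓ ψ)

section UniformPower

variable {Ψ : Type*} [Fintype Ψ] {p : VCCParams Ψ} {ℓ : Ψ → ℝ} {R : ℝ}

lemma uniformPower_nonneg (hβ : ∀ ψ k, 0 ≤ p.β ψ k) (hN : 0 ≤ p.N₀) (hξ : 0 ≤ p.ξ)
    (hℓ : ∀ ψ, 0 ≤ ℓ ψ) (hR : 0 ≤ R) (ψ : Ψ) (k : Fin p.Q) (q : Fin (p.M ψ k)) :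
    0 ≤ p.uniformPower ℓ R ψ k q :=
  div_nonneg (mul_nonneg hN (sub_nonneg.2 (Real.one_le_exp (by positivity))))
    (mul_nonneg (hβ ψ k) (hℓ ψ))

lemma sum_uniformPower (p : VCCParams Ψ) (ℓ : Ψ → ℝ) (R : ℝ) :
    ∑ ψ, ∑ k, ∑ q, p.uniformPower ℓ R ψ k q = p.requiredPower ℓ R := by
  refine Finset.sum_congr rfl fun ψ _ => Finset.sum_congr rfl fun k _ => ?_
  simp only [uniformPower, Finset.sum_const, Finset.card_univ, Fintype.card_fin, nsmul_eq_mul]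
  ring

end UniformPower

namespace IsGroupwiseRayleigh

variable {Ψ : Type*} [Fintype Ψ] [Nonempty Ψ] {p : VCCParams Ψ} {Ω : Type*} [MeasurableSpace Ω]
  {μ : Measure Ω} [IsProbabilityMeasure μ] {H : Ω → p.Channel} {P : p.Power} {R : ℝ}

lemma le_avgUserRate_uniformPower (hH : p.IsGroupwiseRayleigh μ H) (hM : ∀ ψ k, 0 < p.M ψ k)
    (hβ : ∀ ψ k, 0 < p.β ψ k) (hL : ∀ ψ, p.Mgrp ψ < p.L) (hN : 0 < p.N₀) (hξ : 0 < p.ξ)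
    (hR : 0 ≤ R) (ψ : Ψ) (k : Fin p.Q) :
    R / (G (Ψ := Ψ) * p.Q) ≤
      p.avgUserRate μ H (p.uniformPower (fun ψ => p.L - p.Mgrp ψ) R) ψ k := by
  have hG : 0 < G (Ψ := Ψ) := Fintype.card_pos
  have hQ : 0 < p.Q := k.pos
  have hMψ := hM ψ k
  have hℓ : ∀ ψ, 0 < (p.L : ℝ) - p.Mgrp ψ := fun ψ => sub_pos.2 (by exact_mod_cast hL ψ)
  refine le_trans (le_of_eq ?_) (hH.le_avgUserRate (hβ ψ) (hL ψ) hN.le hξ.le k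
    (uniformPower_nonneg (fun ψ k => (hβ ψ k).le) hN.le hξ.le (fun ψ => (hℓ ψ).le) hR ψ k))
  have hstream : ∀ q, Real.log (1 + p.uniformPower (fun ψ => p.L - p.Mgrp ψ) R ψ k q / p.N₀ *
      (p.β ψ k * (p.L - p.Mgrp ψ))) = R / (p.ξ * G (Ψ := Ψ) * p.Q * p.M ψ k) := by
    intro q
    have := (hβ ψ k).ne'
    have := (hℓ ψ).ne'
    rw [uniformPower, mul_div_assoc, mul_div_cancel_left₀ _ hN.ne',
      div_mul_cancel₀ _ (by positivity), add_sub_cancel, Real.log_exp]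
  simp only [hstream, Finset.sum_const, Finset.card_univ, Fintype.card_fin, nsmul_eq_mul]
  field_simp

lemma le_avgSumRate_of_requiredPower_le (hH : p.IsGroupwiseRayleigh μ H) (hQ : 0 < p.Q)
    (hM : ∀ ψ k, 0 < p.M ψ k) (hβ : ∀ ψ k, 0 < p.β ψ k) (hL : ∀ ψ, p.Mgrp ψ < p.L)
    (hN : 0 < p.N₀) (hξ : 0 < p.ξ) (hP : p.IsMMFOptimal μ H P) (hR : 0 ≤ R)
    (hRP : p.requiredPower (fun ψ => p.L - p.Mgrp ψ) R ≤ p.Ptot) : R ≤ p.avgSumRate μ H P := by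
  have : Nonempty (Fin p.Q) := ⟨⟨0, hQ⟩⟩
  have hG : 0 < G (Ψ := Ψ) := Fintype.card_pos
  have hfeasible : p.Feasible (p.uniformPower (fun ψ => p.L - p.Mgrp ψ) R) := by
    refine ⟨uniformPower_nonneg (fun ψ k => (hβ ψ k).le) hN.le hξ.le (fun ψ => ?_) hR, ?_⟩
    · exact sub_nonneg.2 (by exact_mod_cast (hL ψ).le)
    · rwa [sum_uniformPower]
  rw [hH.avgSumRate_eq hM hβ hL hN hξ hP, ← div_le_iff₀' (by positivity)]
  refine le_trans (le_ciInf fun u => ?_) (hP.2 _ hfeasible)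
  exact hH.le_avgUserRate_uniformPower hM hβ hL hN hξ hR u.1 u.2

end IsGroupwiseRayleigh

end VCCParams

end

open VCCParams in
theorem theorem2_general {Ψ : Type*} [Fintype Ψ] [Nonempty Ψ] (p : VCCParams Ψ)
    (hQ : 0 < p.Q) (hM : ∀ ψ k, 0 < p.M ψ k) (hL : ∀ ψ, p.Mgrp ψ < p.L)
    (hβ : ∀ ψ k, 0 < p.β ψ k) (hN : 0 < p.N₀) (hP : 0 ≤ p.Ptot) (_hT : p.T ≠ 0) (hξ : 0 < p.ξ)
    {Ω : Type*} [MeasurableSpace Ω] (μ : Measure Ω) [IsProbabilityMeasure μ]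
    (H : Ω → p.Channel) (hH : p.IsGroupwiseRayleigh μ H) :
    (∀ P, p.Feasible P → ∀ ψ k, Integrable (fun ω => p.userRate P (H ω) ψ k) μ) ∧
    ∃ Rlow Rbar Rup : ℝ,
      (∀ R, p.IsMMFSumRate μ H R ↔ R = Rbar) ∧
      (∀ R, p.LowerEq R ↔ R = Rlow) ∧
      (∀ R, p.UpperEq R ↔ R = Rup) ∧
      Rlow ≤ Rbar ∧ Rbar ≤ Rup ∧
      (∀ M : ℕ, (∀ ψ k, p.M ψ k = M) →
        Rlow = p.ξ * G (Ψ := Ψ) * p.Q * M *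
          Real.log (1 + p.Ptot * ((p.L : ℝ) - p.Q * M) /
            (M * p.N₀ * ∑ ψ, ∑ k, (p.β ψ k)⁻¹)) ∧
        Rup = p.ξ * G (Ψ := Ψ) * p.Q * M *
          Real.log (1 + p.Ptot * ((p.L : ℝ) - p.Q * M + 1) /
            (M * p.N₀ * ∑ ψ, ∑ k, (p.β ψ k)⁻¹))) := by
  have hlow : ∀ ψ, 0 < (p.L : ℝ) - p.Mgrp ψ := fun ψ => sub_pos.2 (by exact_mod_cast hL ψ)
  have hup : ∀ ψ, 0 < (p.L : ℝ) - p.Mgrp ψ + 1 := fun ψ => by linarith [hlow ψ]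
  obtain ⟨P, hopt⟩ := hH.exists_isMMFOptimal hQ hβ hL hN.le hP
  obtain ⟨Rlow, hRlow, hlow_iff⟩ := exists_nonneg_requiredPower_eq_iff hQ hM hβ hN hξ hlow hP
  obtain ⟨Rup, -, hup_iff⟩ := exists_nonneg_requiredPower_eq_iff hQ hM hβ hN hξ hup hP
  refine ⟨fun P hP ψ k => hH.integrable_userRate (hβ ψ) (hL ψ) hN.le k (hP.1 ψ k),
    Rlow, p.avgSumRate μ H P, Rup, fun _ => hH.isMMFSumRate_iff hM hβ hL hN hξ hopt, hlow_iff,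
    hup_iff, hH.le_avgSumRate_of_requiredPower_le hQ hM hβ hL hN hξ hopt hRlow
      ((hlow_iff _).2 rfl).le,
    (strictMono_requiredPower hQ hM hβ hN hξ hup).le_iff_le.1 <|
      (hH.requiredPower_avgSumRate_le hM hβ hL hN hξ hopt).trans_eq ((hup_iff _).2 rfl).symm,
    fun M hMM => ?_⟩
  obtain ⟨ψ₀⟩ := ‹Nonempty Ψ›
  have hMgrp : ∀ ψ, (p.Mgrp ψ : ℝ) = p.Q * M := fun ψ => by simp [Mgrp, hMM]
  have hM₀ : 0 < M := hMM ψ₀ ⟨0, hQ⟩ ▸ hM ψ₀ ⟨0, hQ⟩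
  have hl := hMgrp ψ₀ ▸ hlow ψ₀
  constructor
  · exact ((hlow_iff _).1 (requiredPower_mul_log hQ hβ hN hξ hM₀ hMM hl
      (fun ψ => by rw [hMgrp]) hP)).symm
  · exact ((hup_iff _).1 (requiredPower_mul_log hQ hβ hN hξ hM₀ hMM (by linarith)
      (fun ψ => by rw [hMgrp]) hP)).symm

theorem theorem2 {Ψ : Type*} [Fintype Ψ] [Nonempty Ψ] (p : VCCParams Ψ)
    (hQ : 0 < p.Q) (hM : ∀ ψ k, 0 < p.M ψ k) (hL : ∀ ψ, p.Mgrp ψ < p.L)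
    (hβ : ∀ ψ k, 0 < p.β ψ k) (hN : 0 < p.N₀) (hP : 0 < p.Ptot)
    (hT : 0 < p.T) (hΘ : 0 ≤ p.Θ) (hξ : 0 < p.ξ)
    {Ω : Type*} [MeasurableSpace Ω] (μ : MeasureTheory.Measure Ω)
    [MeasureTheory.IsProbabilityMeasure μ] (H : Ω → p.Channel) (hH : p.IsRayleigh μ H) :
    -- the fading averages are finite
    (∀ P, p.Feasible P → ∀ ψ k,
      MeasureTheory.Integrable (fun ω => p.userRate P (H ω) ψ k) μ) ∧
    ∃ Rlow Rbar Rup : ℝ,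
      -- `Rbar` is the MMF-optimized sum-rate, `Rlow` and `Rup` are the roots of the two equations
      (∀ R, p.IsMMFSumRate μ H R ↔ R = Rbar) ∧
      (∀ R, p.LowerEq R ↔ R = Rlow) ∧
      (∀ R, p.UpperEq R ↔ R = Rup) ∧
      Rlow ≤ Rbar ∧ Rbar ≤ Rup ∧
      -- closed forms if all users have the same number of antennas
      (∀ M : ℕ, (∀ ψ k, p.M ψ k = M) →
        Rlow = p.ξ * VCCParams.G (Ψ := Ψ) * p.Q * M *
          Real.log (1 + p.Ptot * ((p.L : ℝ) - p.Q * M) /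
            (M * p.N₀ * ∑ ψ, ∑ k, (p.β ψ k)⁻¹)) ∧
        Rup = p.ξ * VCCParams.G (Ψ := Ψ) * p.Q * M *
          Real.log (1 + p.Ptot * ((p.L : ℝ) - p.Q * M + 1) /
            (M * p.N₀ * ∑ ψ, ∑ k, (p.β ψ k)⁻¹))) :=
  theorem2_general p hQ hM hL hβ hN hP.le hT.ne' hξ μ H hH.isGroupwiseRayleigh
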